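/- Let $\Omega^+$ be the convex cone of continuous functions $f:\mathbb{R}\to[0,\infty)$ that are positive definite, i.e. $\sum_{j,k=1}^n c_j\overline{c_k}f(x_j-x_k)\ge 0$ for all $n$, all $x_1,\dots,x_n\in\mathbb{R}$ and all $c_1,\dots,c_n\in\mathbb{C}$. A function $f\in\Omega^+$, $f\neq 0$, is an extremal ray generator if $\Omega^+\cap(f-\Omega^+)=\{\lambda f: 0\le\lambda\le 1\}$. Put $H_0(x)=1$, $H_2(x)=4\pi x^2-1$, $H_4(x)=(4\pi x^2)^2-6(4\pi x^2)+3$ and, for $a,b\in\mathbb{R}$, $$f_{a,b}(x)=\bigl(H_0(x)+2aH_2(x)+bH_4(x)\bigr)e^{-\pi x^2}.$$ Let $\widehat f(\xi)=\int_{\mathbb{R}} f(x)e^{-2i\pi x\xi}\,dx$ (for even functions the sign in the exponent is immaterial). Suppose that $f_{a,b}$ is an extremal ray generator. It is said to be of time type if its entire extension to $\mathbb{C}$ has only real zeros and $\widehat{f_{a,b}}\ge 0$ on $\mathbb{R}$; it is said to be of frequency type if the entire extension of $\widehat{f_{a,b}}$ has only real zeros and $f_{a,b}\ge 0$ on $\mathbb{R}$.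 Let $N\ge 1$ and $a_1,b_1,\dots,a_N,b_N\in\mathbb{R}$. (1) If $f_{a_1,b_1},\dots,f_{a_N,b_N}$ are all of time type, then the product $\prod_{i=1}^N f_{a_i,b_i}$ is an extremal ray generator of $\Omega^+$. If moreover all $b_i\ne 0$, it has the form $P(x)e^{-N\pi x^2}$ with $P$ a real polynomial of degree $4N$. (2) If $f_{a_1,b_1},\dots,f_{a_N,b_N}$ are all of frequency type, then the convolution $f_{a_1,b_1}*\cdots*f_{a_N,b_N}$ is an extremal ray generator of $\Omega^+$. If moreover all $b_i\ne 0$, it has the form $P(x)e^{-\pi x^2/N}$ with $P$ a real polynomial of degree $4N$. (3) For every $N\ge 1$ there is a real polynomial $P$ of degree $4N$ such that $P(x)e^{-\pi x^2}$ is an extremal ray generator of $\Omega^+$. In particular there are extremal Hermite functions of arbitrarily high degree. -/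

import Mathlib

open MeasureTheory Polynomial
open scoped FourierTransform ComplexConjugate ComplexOrder Convolution

noncomputable section

namespace HermiteRays

/-- `f` is a positive definite function on the line. In the order of `ℂ`, `0 ≤ z` says that
`z` is real and non-negative. -/
def IsPositiveDefinite (f : ℝ → ℝ) : Prop :=
  ∀ (n : ℕ) (x : Fin n → ℝ) (c : Fin n → ℂ),
    0 ≤ ∑ j, ∑ k, c j * conj (c k) * (f (x j - x k) : ℂ)

/-- The cone `Ω⁺` of continuous, non-negative, positive definite functions on the line
(such functions are automatically even). -/
def posCone : Set (ℝ → ℝ) :=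
  {f | Continuous f ∧ (∀ x, 0 ≤ f x) ∧ IsPositiveDefinite f}

/-- The interval `I(f) = Ω⁺ ∩ (f - Ω⁺)` generated by `f`. -/
def interval (f : ℝ → ℝ) : Set (ℝ → ℝ) :=
  {g | g ∈ posCone ∧ ∃ h ∈ posCone, g = f - h}

/-- `f` generates an extremal ray of `Ω⁺`. -/
def IsExtremal (f : ℝ → ℝ) : Prop :=
  f ∈ posCone ∧ f ≠ 0 ∧ interval f = {g | ∃ t : ℝ, 0 ≤ t ∧ t ≤ 1 ∧ g = t • f}

/-- The Hermite polynomial `H₀`. -/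
def H₀ : ℝ[X] := 1

/-- The Hermite polynomial `H₂ = 4πx² - 1`. -/
def H₂ : ℝ[X] := C (4 * Real.pi) * X ^ 2 - 1

/-- The Hermite polynomial `H₄ = (4πx²)² - 6(4πx²) + 3`. -/
def H₄ : ℝ[X] :=
  (C (4 * Real.pi) * X ^ 2) ^ 2 - 6 * (C (4 * Real.pi) * X ^ 2) + 3

/-- The Hermite function `P(x) exp (-π lam x²)`. -/
def hermiteFun (P : ℝ[X]) (lam : ℝ) (x : ℝ) : ℝ :=
  P.eval x * Real.exp (-Real.pi * lam * x ^ 2)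

/-- `f_{a,b} = (H₀ + 2a H₂ + b H₄) exp (-π x²)`. -/
def fab (a b : ℝ) : ℝ → ℝ :=
  hermiteFun (H₀ + C (2 * a) * H₂ + C b * H₄) 1

/-- The Fourier transform of a real function. -/
def fourierHat (f : ℝ → ℝ) : ℝ → ℂ := 𝓕 (fun x => (f x : ℂ))

/-- `g` extends to an entire function all of whose complex zeros are real. The extension is
unique, by the identity theorem. -/
def HasOnlyRealZeros (g : ℝ → ℂ) : Prop :=
  ∃ G : ℂ → ℂ, Differentiable ℂ G ∧ (∀ x : ℝ, G x = g x) ∧ ∀ z : ℂ, G z = 0 → z.im = 0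

/-- The extremal function `f_{a,b}` is of the time type. -/
def IsTimeType (a b : ℝ) : Prop :=
  IsExtremal (fab a b) ∧ HasOnlyRealZeros (fun x => (fab a b x : ℂ)) ∧
    ∀ ξ, 0 ≤ fourierHat (fab a b) ξ

/-- The extremal function `f_{a,b}` is of the frequency type. -/
def IsFrequencyType (a b : ℝ) : Prop :=
  IsExtremal (fab a b) ∧ HasOnlyRealZeros (fourierHat (fab a b)) ∧ ∀ x, 0 ≤ fab a b x

/-- The convolution `F 0 ⋆ F 1 ⋆ ⋯ ⋆ F n`, bracketed to the left. -/
def iterConv : (n : ℕ) → (Fin (n + 1) → ℝ → ℝ) → ℝ → ℝ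
  | 0, F => F 0
  | n + 1, F =>
      convolution (iterConv n (fun i => F i.castSucc)) (F (Fin.last (n + 1)))
        (ContinuousLinearMap.mul ℝ ℝ) volume

end HermiteRays

end

/-! Suppose `f = g + g'` inside the cone, where `f` is a polynomial `P` with only real zeros times a
Gaussian. Then `0 ≤ g ≤ f`. Integrable positive definite functions have non-negative transforms, so
the transforms also satisfy `0 ≤ ĝ ≤ f̂`. Since `f̂` has Gaussian decay, `g`, being the transform of
`ĝ`, is entire, and `|g(x + iy)| ≤ f(iy)`. Multiply `g` by the reciprocal Gaussian to get `H`: on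
the real line `|H| ≤ |P|`, and elsewhere `|H(x + iy)|` is at most a polynomial in `|y|` times `exp
(A x²)`. Phragmén–Lindelöf in each quadrant turns this into polynomial growth of degree `deg P`.
Every zero of `P` is real, so `|H| ≤ |P|` makes `P` divide `H`, and the quotient is constant by
Liouville. Hence `g = k f`. This Hardy-type argument is `exists_fourier_eq_const_mul`.

It is used on both sides of the Fourier transform: `isExtremal_of_real_zeros` when `f` has real
zeros, `isExtremal_of_fourierHat_real_zeros` when `f̂` does. Products preserve the cone (Schur) and
the reality of zeros, which gives the time case. Convolutions become products after transforming,
and the transform of `fab a b` is `fab (-a) b`, which gives the frequency case. For a fixed Gaussian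
and arbitrary degree, one explicit member of the family is rescaled and raised to a power. -/

noncomputable section

namespace HermiteRays

/-! ### Polynomials times Gaussians and their Fourier transforms -/

/-- A complex polynomial times the Gaussian `exp (-π lam x²)`. -/
def polyGauss (P : ℂ[X]) (lam : ℝ) (x : ℝ) : ℂ :=
  P.eval (x : ℂ) * (Real.exp (-Real.pi * lam * x ^ 2) : ℂ)

lemma ofReal_hermiteFun (P : ℝ[X]) (lam x : ℝ) :
    ((hermiteFun P lam x : ℝ) : ℂ) = polyGauss (P.map Complex.ofRealHom) lam x := by
  have h := Polynomial.eval_map_apply (p := P) Complex.ofRealHom x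
  simp only [Complex.ofRealHom_eq_coe] at h
  simp [hermiteFun, polyGauss, h]

@[fun_prop]
lemma continuous_polyGauss (P : ℂ[X]) (lam : ℝ) : Continuous (polyGauss P lam) := by
  unfold polyGauss
  have := P.continuous
  fun_prop

@[fun_prop]
lemma continuous_hermiteFun (P : ℝ[X]) (lam : ℝ) : Continuous (hermiteFun P lam) := by
  unfold hermiteFun
  have := P.continuous
  fun_prop

lemma exists_norm_eval_le_exp (P : ℂ[X]) :
    ∃ C : ℝ, 0 ≤ C ∧ ∀ z : ℂ, ‖P.eval z‖ ≤ C * Real.exp ‖z‖ := by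
  induction P using Polynomial.induction_on' with
  | add p q hp hq =>
    obtain ⟨C, hC, h⟩ := hp
    obtain ⟨D, hD, h'⟩ := hq
    refine ⟨C + D, by positivity, fun z => ?_⟩
    rw [eval_add, add_mul]
    exact (norm_add_le _ _).trans (add_le_add (h z) (h' z))
  | monomial n a =>
    refine ⟨‖a‖ * n.factorial, by positivity, fun z => ?_⟩
    have h := Real.pow_div_factorial_le_exp ‖z‖ (norm_nonneg z) n
    rw [div_le_iff₀ (by positivity)] at h
    rw [eval_monomial, norm_mul, norm_pow, mul_assoc, mul_comm (n.factorial : ℝ)]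
    gcongr

lemma exists_norm_polyGauss_le (P : ℂ[X]) {lam : ℝ} (hlam : 0 < lam) :
    ∃ C : ℝ, 0 ≤ C ∧ ∀ x, ‖polyGauss P lam x‖ ≤ C * Real.exp (-(Real.pi * lam / 2) * x ^ 2) := by
  obtain ⟨C, hC, h⟩ := exists_norm_eval_le_exp P
  have hc : 0 < Real.pi * lam / 2 := by positivity
  set c := Real.pi * lam / 2 with hcdef
  -- Half of the Gaussian is spent on `exp |x|`, through `|x| ≤ c x² + 1 / (4c)`.
  refine ⟨C * Real.exp (1 / (4 * c)), by positivity, fun x => ?_⟩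
  have hx : ‖(x : ℂ)‖ ≤ c * x ^ 2 + 1 / (4 * c) := by
    rw [Complex.norm_real, Real.norm_eq_abs]
    have : c * x ^ 2 + 1 / (4 * c) - |x| = c * (|x| - 1 / (2 * c)) ^ 2 := by
      rw [← sq_abs x]; field_simp; ring
    have h2 : 0 ≤ c * (|x| - 1 / (2 * c)) ^ 2 := by positivity
    linarith
  rw [polyGauss, norm_mul, Complex.norm_real, Real.norm_eq_abs, Real.abs_exp]
  calc _ ≤ C * Real.exp (c * x ^ 2 + 1 / (4 * c)) * Real.exp (-Real.pi * lam * x ^ 2) := by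
        gcongr
        exact (h x).trans (by gcongr)
    _ = _ := by
        rw [mul_assoc C, mul_assoc C, ← Real.exp_add, ← Real.exp_add, hcdef]
        ring_nf

lemma integrable_of_norm_le_gaussian {f : ℝ → ℂ} (hf : Continuous f) {C c : ℝ} (hc : 0 < c)
    (h : ∀ x, ‖f x‖ ≤ C * Real.exp (-c * x ^ 2)) : Integrable f :=
  ((integrable_exp_neg_mul_sq hc).const_mul C).mono' hf.aestronglyMeasurable
    (Filter.Eventually.of_forall h)

lemma integrable_polyGauss (P : ℂ[X]) {lam : ℝ} (hlam : 0 < lam) :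
    Integrable (polyGauss P lam) := by
  obtain ⟨C, -, h⟩ := exists_norm_polyGauss_le P hlam
  exact integrable_of_norm_le_gaussian (by fun_prop) (by positivity) h

lemma integrable_hermiteFun (P : ℝ[X]) {lam : ℝ} (hlam : 0 < lam) :
    Integrable (hermiteFun P lam) := by
  have := (integrable_polyGauss (P.map Complex.ofRealHom) hlam).re
  refine this.congr (Filter.Eventually.of_forall fun x => ?_)
  simp [← ofReal_hermiteFun]

lemma fourier_eq_integral_exp_mul (f : ℝ → ℂ) (w : ℝ) :
    𝓕 f w = ∫ v : ℝ, Complex.exp (-2 * Real.pi * Complex.I * w * v) * f v := by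
  rw [Real.fourier_eq']
  congr 1
  ext v
  simp only [RCLike.inner_apply, conj_trivial, smul_eq_mul]
  congr 2
  push_cast
  ring

lemma fourier_const_smul (a : ℂ) (f : ℝ → ℂ) : 𝓕 (a • f) = a • 𝓕 f :=
  VectorFourier.fourierIntegral_const_smul Real.fourierChar volume (innerₗ ℝ) f a

lemma fourier_add {f g : ℝ → ℂ} (hf : Integrable f) (hg : Integrable g) :
    𝓕 (f + g) = 𝓕 f + 𝓕 g :=
  VectorFourier.fourierIntegral_add (L := innerₗ ℝ) Real.continuous_fourierChar
    continuous_inner hf hg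

lemma continuous_fourier {f : ℝ → ℂ} (hf : Integrable f) : Continuous (𝓕 f) :=
  VectorFourier.fourierIntegral_continuous (L := innerₗ ℝ) Real.continuous_fourierChar
    continuous_inner hf

/-- Multiplication by `x` becomes `i / (2π)` times differentiation on the Fourier side; the second
term comes from differentiating the Gaussian. -/
lemma fourier_polyGauss_X_mul {P Q : ℂ[X]} {lam : ℝ} (hlam : 0 < lam)
    (h : 𝓕 (polyGauss P lam) = polyGauss Q lam⁻¹) :
    𝓕 (polyGauss (X * P) lam) = polyGauss
      (C (Complex.I / (2 * Real.pi)) * derivative Q - C (Complex.I * (lam⁻¹ : ℝ)) * (X * Q))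
        lam⁻¹ := by
  have hX : (fun x : ℝ => x • polyGauss P lam x) = polyGauss (X * P) lam := by
    ext x
    simp [polyGauss, mul_assoc]
  have hpi : (Real.pi : ℂ) ≠ 0 := by exact_mod_cast Real.pi_ne_zero
  ext w
  have h1 := Real.hasDerivAt_fourier (integrable_polyGauss P hlam)
    (hX ▸ integrable_polyGauss (X * P) hlam) w
  have h2 : (fun x : ℝ => (-2 * Real.pi * Complex.I * x : ℂ) • polyGauss P lam x) =
      (-2 * Real.pi * Complex.I : ℂ) • polyGauss (X * P) lam := by
    ext x
    simp [polyGauss]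
    ring
  have h3 : HasDerivAt (polyGauss Q lam⁻¹)
      ((derivative Q).eval (w : ℂ) * (Real.exp (-Real.pi * lam⁻¹ * w ^ 2) : ℂ) +
        Q.eval (w : ℂ) * ((Real.exp (-Real.pi * lam⁻¹ * w ^ 2) *
          (-Real.pi * lam⁻¹ * (2 * w)) : ℝ) : ℂ)) w := by
    have hq := (Q.hasDerivAt (w : ℂ)).comp_ofReal
    have he : HasDerivAt (fun x : ℝ => Real.exp (-Real.pi * lam⁻¹ * x ^ 2))
        (Real.exp (-Real.pi * lam⁻¹ * w ^ 2) * (-Real.pi * lam⁻¹ * (2 * w))) w := by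
      have := ((hasDerivAt_pow 2 w).const_mul (-Real.pi * lam⁻¹)).exp
      simpa using this
    exact hq.mul he.ofReal_comp
  rw [h, h2, show 𝓕 ((-2 * Real.pi * Complex.I : ℂ) • polyGauss (X * P) lam) w =
    (-2 * Real.pi * Complex.I : ℂ) • 𝓕 (polyGauss (X * P) lam) w by
      rw [fourier_const_smul]; rfl] at h1
  have h4 := h1.unique h3
  have h5 : 𝓕 (polyGauss (X * P) lam) w = (Complex.I / (2 * Real.pi)) *
      ((-2 * Real.pi * Complex.I : ℂ) • 𝓕 (polyGauss (X * P) lam) w) := by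
    rw [smul_eq_mul]
    field_simp
    rw [Complex.I_sq]; ring
  rw [h5, h4]
  simp [polyGauss]
  field_simp
  ring

lemma fourier_polyGauss_add (P Q : ℂ[X]) {lam : ℝ} (hlam : 0 < lam) :
    𝓕 (polyGauss (P + Q) lam) = 𝓕 (polyGauss P lam) + 𝓕 (polyGauss Q lam) := by
  rw [← fourier_add (integrable_polyGauss P hlam) (integrable_polyGauss Q hlam)]
  congr 1
  ext x
  simp [polyGauss, add_mul]

lemma fourier_polyGauss_C_mul (a : ℂ) (P : ℂ[X]) (lam : ℝ) :
    𝓕 (polyGauss (C a * P) lam) = a • 𝓕 (polyGauss P lam) := by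
  rw [← fourier_const_smul]
  congr 1
  ext x
  simp [polyGauss, mul_assoc]

lemma fourier_polyGauss_one {lam : ℝ} (hlam : 0 < lam) :
    𝓕 (polyGauss 1 lam) = polyGauss (C (1 / (lam : ℂ) ^ (1 / 2 : ℂ))) lam⁻¹ := by
  have h := fourier_gaussian_pi (b := (lam : ℂ)) (by simpa using hlam)
  have h1 : polyGauss 1 lam = fun x : ℝ => Complex.exp (-Real.pi * lam * x ^ 2) := by
    ext x; simp [polyGauss]
  rw [h1, h]
  ext t
  simp [polyGauss, div_eq_mul_inv]

lemma exists_fourier_polyGauss_X_pow {lam : ℝ} (hlam : 0 < lam) (n : ℕ) :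
    ∃ Q : ℂ[X], Q.degree = n ∧ 𝓕 (polyGauss (X ^ n) lam) = polyGauss Q lam⁻¹ := by
  have hl : (lam : ℂ) ≠ 0 := by exact_mod_cast hlam.ne'
  induction n with
  | zero =>
    refine ⟨_, ?_, by simpa using fourier_polyGauss_one hlam⟩
    rw [degree_C (by simp [hl])]; simp
  | succ n ih =>
    obtain ⟨Q, hQ, h⟩ := ih
    refine ⟨_, ?_, by rw [pow_succ']; exact fourier_polyGauss_X_mul hlam h⟩
    -- The `X * Q` term outranks the derivative, so each step raises the degree by exactly one. The
    -- exact degree is what the convolution statement needs.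
    have h1 : (C (Complex.I * (lam⁻¹ : ℝ)) * (X * Q)).degree = ((n + 1 : ℕ) : WithBot ℕ) := by
      rw [degree_C_mul (by simp [hl]), degree_mul, degree_X, hQ]
      push_cast; ring
    rw [degree_sub_eq_right_of_degree_lt, h1]
    rw [h1]
    calc _ ≤ (derivative Q).degree := by
          refine (degree_mul_le _ _).trans ?_
          grw [degree_C_le, zero_add]
      _ ≤ Q.degree := degree_derivative_le
      _ < _ := by rw [hQ]; exact_mod_cast n.lt_succ_self

lemma exists_fourier_polyGauss (P : ℂ[X]) {lam : ℝ} (hlam : 0 < lam) :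
    ∃ Q : ℂ[X], Q.degree = P.degree ∧ 𝓕 (polyGauss P lam) = polyGauss Q lam⁻¹ := by
  induction hn : P.degree using WellFoundedLT.induction generalizing P with
  | ind n ih =>
    by_cases hP : P = 0
    · refine ⟨0, by simp [← hn, hP], ?_⟩
      have := fourier_polyGauss_C_mul 0 0 lam
      simp only [zero_smul, C_0, zero_mul] at this
      rw [hP, this]
      ext x; simp [polyGauss]
    · obtain ⟨Q₁, hd₁, h₁⟩ := ih P.eraseLead.degree (hn ▸ degree_eraseLead_lt hP) _ rfl
      obtain ⟨Q₂, hd₂, h₂⟩ := exists_fourier_polyGauss_X_pow hlam P.natDegree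
      have hlc : P.leadingCoeff ≠ 0 := leadingCoeff_ne_zero.mpr hP
      have hd : (C P.leadingCoeff * Q₂).degree = P.degree := by
        rw [degree_C_mul hlc, hd₂, degree_eq_natDegree hP]
      refine ⟨Q₁ + C P.leadingCoeff * Q₂, ?_, ?_⟩
      · rw [degree_add_eq_right_of_degree_lt, hd, hn]
        rw [hd, hd₁]
        exact degree_eraseLead_lt hP
      · conv_lhs => rw [← eraseLead_add_C_mul_X_pow P]
        rw [fourier_polyGauss_add _ _ hlam, fourier_polyGauss_C_mul, h₁, h₂]
        ext x
        simp [polyGauss]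
        ring

/-! ### Positive definite functions and non-negative transforms -/

lemma IsPositiveDefinite.even {f : ℝ → ℝ} (hf : IsPositiveDefinite f) (x : ℝ) :
    f (-x) = f x := by
  -- With coefficients `1, i`, the imaginary part of the form is `f (-x) - f x`.
  have h := (Complex.nonneg_iff.mp (hf 2 ![x, 0] ![1, Complex.I])).2
  simp [Fin.sum_univ_two] at h
  linarith

lemma IsPositiveDefinite.posSemidef {f : ℝ → ℝ} (hf : IsPositiveDefinite f) {n : ℕ}
    (x : Fin n → ℝ) : (Matrix.of fun j k => (f (x j - x k) : ℂ)).PosSemidef := by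
  refine Matrix.posSemidef_iff_dotProduct_mulVec.mpr ⟨?_, fun c => ?_⟩
  · ext j k
    simp only [Matrix.conjTranspose_apply, Matrix.of_apply, RCLike.star_def, Complex.conj_ofReal]
    rw [← hf.even, neg_sub]
  · have h := hf n x (fun j => conj (c j))
    simp only [Complex.conj_conj] at h
    convert h using 1
    simp only [dotProduct, Matrix.mulVec, Matrix.of_apply, Pi.star_apply, RCLike.star_def,
      Finset.mul_sum]
    refine Finset.sum_congr rfl fun j _ => Finset.sum_congr rfl fun k _ => ?_
    ring

lemma IsPositiveDefinite.of_posSemidef {f : ℝ → ℝ}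
    (h : ∀ (n : ℕ) (x : Fin n → ℝ), (Matrix.of fun j k => (f (x j - x k) : ℂ)).PosSemidef) :
    IsPositiveDefinite f := by
  intro n x c
  have h := (h n x).dotProduct_mulVec_nonneg (fun j => conj (c j))
  convert h using 1
  simp only [dotProduct, Matrix.mulVec, Matrix.of_apply, Pi.star_apply, RCLike.star_def,
    Finset.mul_sum, Complex.conj_conj]
  refine Finset.sum_congr rfl fun j _ => Finset.sum_congr rfl fun k _ => ?_
  ring

/-- Schur: products of positive definite functions are positive definite. -/
lemma IsPositiveDefinite.mul {f g : ℝ → ℝ} (hf : IsPositiveDefinite f)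
    (hg : IsPositiveDefinite g) : IsPositiveDefinite (fun x => f x * g x) := by
  refine .of_posSemidef fun n x => ?_
  have h := (hf.posSemidef x).hadamard (hg.posSemidef x)
  have heq : (Matrix.of fun j k => ((f (x j - x k) * g (x j - x k) : ℝ) : ℂ)) =
      (Matrix.of fun j k => (f (x j - x k) : ℂ)).hadamard
        (Matrix.of fun j k => (g (x j - x k) : ℂ)) := by
    ext j k
    simp
  rw [heq]
  exact h

lemma isPositiveDefinite_one : IsPositiveDefinite (fun _ => 1) := by
  intro n x c
  have : ∑ j, ∑ k, c j * conj (c k) * ((1 : ℝ) : ℂ) = (∑ j, c j) * conj (∑ k, c k) := by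
    simp [Finset.sum_mul_sum]
  rw [this]
  exact mul_star_self_nonneg _

lemma IsPositiveDefinite.prod {ι : Type*} (s : Finset ι) {f : ι → ℝ → ℝ}
    (hf : ∀ i ∈ s, IsPositiveDefinite (f i)) : IsPositiveDefinite (fun x => ∏ i ∈ s, f i x) := by
  classical
  induction s using Finset.induction_on with
  | empty => simpa using isPositiveDefinite_one
  | insert i s hi ih =>
    simp only [Finset.prod_insert hi]
    exact (hf i (by simp)).mul (ih fun j hj => hf j (by simp [hj]))

lemma IsPositiveDefinite.comp_mul {f : ℝ → ℝ} (hf : IsPositiveDefinite f) (a : ℝ) :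
    IsPositiveDefinite (fun x => f (a * x)) := by
  intro n x c
  simpa [mul_sub] using hf n (fun j => a * x j) c

lemma IsPositiveDefinite.const_mul {f : ℝ → ℝ} (hf : IsPositiveDefinite f) {a : ℝ} (ha : 0 ≤ a) :
    IsPositiveDefinite (fun x => a * f x) := by
  intro n x c
  have h := mul_nonneg (Complex.zero_le_real.mpr ha) (hf n x c)
  convert h using 1
  simp only [Finset.mul_sum]
  refine Finset.sum_congr rfl fun j _ => Finset.sum_congr rfl fun k _ => ?_
  push_cast
  ring

/-- The Fourier transform of a non-negative integrable function is positive definite. -/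
lemma isPositiveDefinite_of_fourierHat {f u : ℝ → ℝ} (hu : ∀ x, 0 ≤ u x) (hi : Integrable u)
    (h : ∀ x, (f x : ℂ) = fourierHat u x) : IsPositiveDefinite f := by
  intro n x c
  set e : Fin n → ℝ → ℂ := fun j v => c j * Complex.exp (-2 * Real.pi * Complex.I * x j * v)
  have hint : ∀ y : ℝ, Integrable
      (fun v : ℝ => Complex.exp (-2 * Real.pi * Complex.I * y * v) * (u v : ℂ)) := by
    intro y
    refine hi.ofReal.bdd_mul (c := 1) (by fun_prop) (Filter.Eventually.of_forall fun v => ?_)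
    rw [Complex.norm_exp]
    simp
  -- The quadratic form is the integral of `|∑ c_j exp (-2πi x_j v)|²` against `u`.
  have key : ∀ v : ℝ, ∑ j, ∑ k, c j * conj (c k) *
      (Complex.exp (-2 * Real.pi * Complex.I * ((x j - x k : ℝ) : ℂ) * v) * (u v : ℂ)) =
      (∑ j, e j v) * conj (∑ j, e j v) * (u v : ℂ) := by
    intro v
    rw [map_sum, Finset.sum_mul_sum, Finset.sum_mul]
    refine Finset.sum_congr rfl fun j _ => ?_
    rw [Finset.sum_mul]
    refine Finset.sum_congr rfl fun k _ => ?_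
    simp only [e, map_mul, ← Complex.exp_conj]
    rw [show -2 * Real.pi * Complex.I * ((x j - x k : ℝ) : ℂ) * v =
      -2 * Real.pi * Complex.I * x j * v + 2 * Real.pi * Complex.I * x k * v by push_cast; ring,
      Complex.exp_add]
    simp [Complex.conj_ofNat]
    ring
  have : ∑ j, ∑ k, c j * conj (c k) * (f (x j - x k) : ℂ) =
      ∫ v, (∑ j, e j v) * conj (∑ j, e j v) * (u v : ℂ) := by
    simp_rw [← key]
    rw [integral_finsetSum]
    · refine Finset.sum_congr rfl fun j _ => ?_
      rw [integral_finsetSum]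
      · refine Finset.sum_congr rfl fun k _ => ?_
        rw [integral_const_mul, h, fourierHat, fourier_eq_integral_exp_mul]
      · exact fun k _ => (hint _).const_mul _
    · exact fun j _ => integrable_finsetSum _ fun k _ => (hint _).const_mul _
  rw [this]
  refine integral_nonneg fun v => mul_nonneg (mul_star_self_nonneg _) ?_
  exact Complex.zero_le_real.mpr (hu v)

/-- Sampling: if all the sums `∑ φ (x j - x k)` are non-negative, so is the mean of
`φ (x - y)` for independent `x`, `y` with the same law. -/
lemma integral_prod_sub_nonneg {φ : ℝ → ℂ} (hφ : Continuous φ) {B : ℝ} (hB : ∀ x, ‖φ x‖ ≤ B)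
    (h : ∀ (n : ℕ) (x : Fin n → ℝ), 0 ≤ ∑ j, ∑ k, φ (x j - x k))
    (μ : Measure ℝ) [IsProbabilityMeasure μ] :
    0 ≤ ∫ p : ℝ × ℝ, φ (p.1 - p.2) ∂(μ.prod μ) := by
  set J := ∫ p : ℝ × ℝ, φ (p.1 - p.2) ∂(μ.prod μ) with hJ
  have hint : ∀ n (j k : Fin n),
      Integrable (fun x : Fin n → ℝ => φ (x j - x k)) (Measure.pi fun _ => μ) := fun n j k =>
    Integrable.of_bound (by fun_prop) B (Filter.Eventually.of_forall fun x => hB _)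
  have hpair : ∀ n (j k : Fin n), j ≠ k →
      ∫ x : Fin n → ℝ, φ (x j - x k) ∂(Measure.pi fun _ => μ) = J := by
    intro n j k hjk
    have hind := (ProbabilityTheory.iIndepFun_pi (μ := fun _ : Fin n => μ)
      (X := fun _ => id) (fun _ => aemeasurable_id)).indepFun hjk
    have hmap : (Measure.pi fun _ : Fin n => μ).map (fun x => (x j, x k)) =
        ((Measure.pi fun _ => μ).map (Function.eval j)).prod
          ((Measure.pi fun _ => μ).map (Function.eval k)) := (ProbabilityTheory.indepFun_iff_map_prod_eq_prod_map_map
      (measurable_id.comp (measurable_pi_apply j)).aemeasurable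
      (measurable_id.comp (measurable_pi_apply k)).aemeasurable).mp hind
    rw [(measurePreserving_eval (fun _ : Fin n => μ) j).map_eq,
      (measurePreserving_eval (fun _ : Fin n => μ) k).map_eq] at hmap
    rw [hJ, ← hmap, integral_map (by fun_prop) (by fun_prop)]
  -- Take the expectation over `n + 1` independent samples: the diagonal gives `φ 0` each time,
  -- every off-diagonal pair gives `J`. Normalising by the number of pairs kills the diagonal in the
  -- limit.
  have hsum : ∀ n : ℕ, 0 ≤ ((n + 1 : ℕ) : ℂ) * φ 0 + ((n + 1 : ℕ) : ℂ) * n * J := by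
    intro n
    have h0 : 0 ≤ ∫ x : Fin (n + 1) → ℝ, ∑ j, ∑ k, φ (x j - x k) ∂(Measure.pi fun _ => μ) :=
      integral_nonneg fun x => h _ x
    rw [integral_finsetSum _ fun j _ => integrable_finsetSum _ fun k _ => hint _ j k] at h0
    have h1 : ∀ j : Fin (n + 1), ∫ x : Fin (n + 1) → ℝ, ∑ k, φ (x j - x k)
        ∂(Measure.pi fun _ => μ) = φ 0 + n * J := by
      intro j
      rw [integral_finsetSum _ fun k _ => hint _ j k, ← Finset.add_sum_erase _ _
        (Finset.mem_univ j), Finset.sum_congr rfl fun k hk =>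
          hpair _ j k (Finset.ne_of_mem_erase hk).symm]
      simp
    simp_rw [h1] at h0
    simpa [mul_add, mul_assoc] using h0
  have hlim : Filter.Tendsto (fun n : ℕ => ((1 / ((n : ℝ) + 1) : ℝ) : ℂ) * φ 0 + J)
      Filter.atTop (nhds J) := by
    have := ((Complex.continuous_ofReal.tendsto 0).comp
      tendsto_one_div_add_atTop_nhds_zero_nat).mul_const (φ 0) |>.add_const J
    simpa [Function.comp_def] using this
  have := Complex.orderClosedTopology
  refine ge_of_tendsto' hlim fun n => ?_
  have h2 := mul_nonneg (Complex.zero_le_real.mpr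
    (show (0 : ℝ) ≤ 1 / (((n : ℝ) + 1 + 1) * ((n : ℝ) + 1)) by positivity)) (hsum (n + 1))
  convert h2 using 1
  have h3 : (n : ℂ) + 1 ≠ 0 := by exact_mod_cast n.succ_ne_zero
  have h4 : (n : ℂ) + 1 + 1 ≠ 0 := by exact_mod_cast (n + 1).succ_ne_zero
  push_cast
  field_simp

/-- The difference of two independent centred Gaussians of variance `s` has variance `2s`, hence
density proportional to `exp (-x² / (4s))`. The mean is thus a Gaussian-regularised integral of `φ`,
and `s → ∞` removes the regularisation. -/
lemma integral_gaussianReal_prod_sub {φ : ℝ → ℂ} (hφ : Continuous φ) {s : NNReal} (hs : s ≠ 0) :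
    ∃ a : ℝ, 0 < a ∧ ∫ p : ℝ × ℝ, φ (p.1 - p.2)
      ∂((ProbabilityTheory.gaussianReal 0 s).prod (ProbabilityTheory.gaussianReal 0 s)) =
      a * ∫ x : ℝ, Complex.exp (-(4 * s : ℝ)⁻¹ * ‖x‖ ^ 2) • φ x := by
  set γ := ProbabilityTheory.gaussianReal 0 s
  have hneg : γ.map (fun x => -x) = γ := by
    simpa [γ] using ProbabilityTheory.gaussianReal_map_neg (μ := 0) (v := s)
  have hconv : (γ.prod γ).map (fun p : ℝ × ℝ => p.1 - p.2) =
      ProbabilityTheory.gaussianReal 0 (s + s) := by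
    have h1 := ProbabilityTheory.gaussianReal_conv_gaussianReal (m₁ := 0) (m₂ := 0)
      (v₁ := s) (v₂ := s)
    rw [add_zero] at h1
    have h2 : γ.prod γ = (γ.prod γ).map (Prod.map id fun x => -x) := by
      rw [← Measure.map_prod_map γ γ measurable_id (by fun_prop), hneg, Measure.map_id]
    rw [← h1, Measure.conv]
    change _ = (γ.prod γ).map _
    conv_rhs => rw [h2]
    rw [Measure.map_map (by fun_prop) (by fun_prop)]
    rfl
  refine ⟨(√(2 * Real.pi * (s + s : NNReal)))⁻¹, by positivity, ?_⟩
  rw [← integral_map (φ := fun p : ℝ × ℝ => p.1 - p.2) (f := φ) (by fun_prop) (by fun_prop), hconv,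
    ProbabilityTheory.integral_gaussianReal_eq_integral_smul (by simpa using hs),
    ← integral_const_mul]
  congr 1
  ext x
  rw [ProbabilityTheory.gaussianPDFReal, Complex.real_smul, smul_eq_mul, Complex.ofReal_mul,
    mul_assoc]
  congr 2
  push_cast
  congr 1
  rw [Real.norm_eq_abs, ← Complex.ofReal_pow, sq_abs]
  push_cast
  ring

/-- A bounded continuous integrable positive definite function has non-negative Fourier
transform. -/
lemma IsPositiveDefinite.fourierHat_nonneg {g : ℝ → ℝ} (hpd : IsPositiveDefinite g)
    (hc : Continuous g) (hi : Integrable g) {B : ℝ} (hB : ∀ x, |g x| ≤ B) (ξ : ℝ) :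
    0 ≤ fourierHat g ξ := by
  set φ : ℝ → ℂ := fun x => Complex.exp (-2 * Real.pi * Complex.I * ξ * x) * (g x : ℂ) with hφ
  have hn : ∀ x : ℝ, ‖Complex.exp (-2 * Real.pi * Complex.I * ξ * x)‖ = 1 := by
    intro x
    rw [Complex.norm_exp]
    simp
  have hφc : Continuous φ := by fun_prop
  have hφi : Integrable φ :=
    hi.ofReal.bdd_mul (c := 1) (by fun_prop) (Filter.Eventually.of_forall fun v => (hn v).le)
  have hφB : ∀ x, ‖φ x‖ ≤ B := by
    intro x
    rw [hφ, norm_mul, hn, one_mul, Complex.norm_real]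
    exact hB x
  -- The modulation is absorbed into the coefficients `c_j = exp (-2πi ξ x_j)`.
  have hφpd : ∀ (n : ℕ) (x : Fin n → ℝ), 0 ≤ ∑ j, ∑ k, φ (x j - x k) := by
    intro n x
    convert hpd n x (fun j => Complex.exp (-2 * Real.pi * Complex.I * ξ * x j)) using 1
    refine Finset.sum_congr rfl fun j _ => Finset.sum_congr rfl fun k _ => ?_
    simp only [hφ]
    rw [← Complex.exp_conj, ← Complex.exp_add]
    congr 2
    simp [Complex.conj_ofNat]
    ring
  have hlim := (Real.tendsto_integral_cexp_sq_smul hφi).comp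
    (tendsto_natCast_atTop_atTop (R := ℝ) |>.const_mul_atTop (show (0 : ℝ) < 4 by norm_num))
  rw [fourierHat, fourier_eq_integral_exp_mul]
  have := Complex.orderClosedTopology
  refine ge_of_tendsto hlim ?_
  filter_upwards [Filter.eventually_gt_atTop 0] with n hpos
  obtain ⟨a, ha, h⟩ := integral_gaussianReal_prod_sub hφc (s := n) (by exact_mod_cast hpos.ne')
  have h0 := integral_prod_sub_nonneg hφc hφB hφpd (ProbabilityTheory.gaussianReal 0 n)
  rw [h] at h0
  have h1 := mul_nonneg (Complex.zero_le_real.mpr (inv_pos.mpr ha).le) h0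
  rw [← mul_assoc, ← Complex.ofReal_mul, inv_mul_cancel₀ ha.ne', Complex.ofReal_one, one_mul] at h1
  simpa using h1

/-! ### Identity theorem and Phragmén–Lindelöf at order two -/

lemma eq_of_eq_on_reals {F G : ℂ → ℂ} (hF : Differentiable ℂ F) (hG : Differentiable ℂ G)
    (h : ∀ x : ℝ, F x = G x) : F = G := by
  refine AnalyticOnNhd.eq_of_frequently_eq (z₀ := 0)
    (hF.differentiableOn.analyticOnNhd isOpen_univ)
    (hG.differentiableOn.analyticOnNhd isOpen_univ) ?_
  have ht : Filter.Tendsto (fun x : ℝ => (x : ℂ)) (nhdsWithin 0 {0}ᶜ) (nhdsWithin 0 {0}ᶜ) := by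
    refine tendsto_nhdsWithin_iff.mpr ⟨?_, ?_⟩
    · exact (Complex.continuous_ofReal.tendsto' 0 0 (by simp)).mono_left nhdsWithin_le_nhds
    · filter_upwards [self_mem_nhdsWithin] with x hx
      simpa using hx
  exact ht.frequently (Filter.Eventually.of_forall h).frequently

lemma norm_exp_I_mul_exp (c : ℝ) (w : ℂ) :
    ‖Complex.exp (Complex.I * c * Complex.exp (2 * w))‖ =
      Real.exp (-(c * (Real.exp (2 * w.re) * Real.sin (2 * w.im)))) := by
  rw [Complex.norm_exp]
  congr 1
  rw [show Complex.I * (c : ℂ) * Complex.exp (2 * w) =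
    (c : ℂ) * (Complex.exp (2 * w) * Complex.I) by ring, Complex.re_ofReal_mul, Complex.mul_I_re,
    Complex.exp_im]
  simp

/-- Phragmén–Lindelöf in a sector of opening `φ < π / 2`, in the logarithmic coordinate. -/
lemma norm_mul_exp_le_of_sector {K : ℂ → ℂ} (hd : ∀ z : ℂ, 0 ≤ z.im → DifferentiableAt ℂ K z)
    {A C : ℝ} (hA : 0 ≤ A) (hC : 0 ≤ C)
    (hK : ∀ z : ℂ, 0 ≤ z.re → 0 ≤ z.im → ‖K z‖ ≤ C * Real.exp (A * z.re ^ 2))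
    (hR : ∀ x : ℝ, 0 ≤ x → ‖K x‖ ≤ C) {φ : ℝ} (hφ : φ < Real.pi / 2) {w : ℂ} (h0 : 0 ≤ w.im)
    (hw : w.im < φ) :
    ‖K (Complex.exp w)‖ * Real.exp (-(A * Real.cos φ / (2 * Real.sin φ) *
      (Real.exp (2 * w.re) * Real.sin (2 * w.im)))) ≤ C := by
  have hφ0 : 0 < φ := h0.trans_lt hw
  have hcos : 0 < Real.cos φ := Real.cos_pos_of_mem_Ioo ⟨by linarith, hφ⟩
  have hsin : 0 < Real.sin φ := Real.sin_pos_of_pos_of_lt_pi hφ0 (by linarith [Real.pi_pos])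
  -- In the coordinate `z = exp w`, the factor `exp (i c z²)` has modulus `exp (-c r² sin 2θ)`. This
  -- `c` makes it cancel `exp (A r² cos² φ)` exactly on the ray `θ = φ`.
  set c := A * Real.cos φ / (2 * Real.sin φ) with hc
  have hc0 : 0 ≤ c := by positivity
  set g : ℂ → ℂ := fun w => K (Complex.exp w) * Complex.exp (Complex.I * c * Complex.exp (2 * w))
    with hg
  have hgn : ∀ w, ‖g w‖ = ‖K (Complex.exp w)‖ *
      Real.exp (-(c * (Real.exp (2 * w.re) * Real.sin (2 * w.im)))) := fun w => by
    rw [hg, norm_mul, norm_exp_I_mul_exp]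
  have hre : ∀ w : ℂ, 0 ≤ w.im → w.im ≤ φ → 0 ≤ (Complex.exp w).re := fun w h1 h2 => by
    rw [Complex.exp_re]
    exact mul_nonneg (Real.exp_pos _).le
      (Real.cos_nonneg_of_mem_Icc ⟨by linarith [Real.pi_pos], by linarith⟩)
  have him : ∀ w : ℂ, 0 ≤ w.im → w.im ≤ φ → 0 ≤ (Complex.exp w).im := fun w h1 h2 => by
    rw [Complex.exp_im]
    exact mul_nonneg (Real.exp_pos _).le (Real.sin_nonneg_of_nonneg_of_le_pi h1
      (by linarith [Real.pi_pos]))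
  have hsin2 : ∀ w : ℂ, 0 ≤ w.im → w.im ≤ φ → 0 ≤ Real.sin (2 * w.im) := fun w h1 h2 =>
    Real.sin_nonneg_of_nonneg_of_le_pi (by linarith) (by linarith)
  rw [← hgn]
  refine PhragmenLindelof.horizontal_strip (a := 0) (b := φ) ?_ ⟨2, ?_, A, ?_⟩ ?_ ?_ h0 hw.le
  · refine DifferentiableOn.diffContOnCl fun z hz => ?_
    have hz' : z ∈ Complex.im ⁻¹' Set.Icc 0 φ := closure_minimal
      (Set.preimage_mono Set.Ioo_subset_Icc_self) (isClosed_Icc.preimage Complex.continuous_im) hz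
    have h1 : DifferentiableAt ℂ (fun w => K (Complex.exp w)) z :=
      (hd _ (him z hz'.1 hz'.2)).comp z Complex.differentiable_exp.differentiableAt
    exact (h1.mul (by fun_prop)).differentiableWithinAt
  · rw [sub_zero, lt_div_iff₀ hφ0]
    linarith
  · refine Asymptotics.IsBigO.of_bound C (Filter.eventually_inf_principal.mpr
      (Filter.Eventually.of_forall fun z hz => ?_))
    rw [hgn, Real.norm_eq_abs, Real.abs_exp]
    have h1 : Real.exp (-(c * (Real.exp (2 * z.re) * Real.sin (2 * z.im)))) ≤ 1 := by
      have := hsin2 z hz.1.le hz.2.le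
      rw [Real.exp_le_one_iff, neg_nonpos]
      positivity
    have h2 : (Complex.exp z).re ^ 2 ≤ Real.exp (2 * |z.re|) := by
      calc (Complex.exp z).re ^ 2 ≤ ‖Complex.exp z‖ ^ 2 := by
            rw [← sq_abs]
            gcongr
            exact Complex.abs_re_le_norm _
        _ = Real.exp (2 * z.re) := by rw [Complex.norm_exp, ← Real.exp_nat_mul]; norm_num
        _ ≤ _ := by gcongr; exact le_abs_self _
    calc _ ≤ ‖K (Complex.exp z)‖ * 1 := by gcongr
      _ ≤ C * Real.exp (A * (Complex.exp z).re ^ 2) := by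
        rw [mul_one]; exact hK _ (hre z hz.1.le hz.2.le) (him z hz.1.le hz.2.le)
      _ ≤ _ := by gcongr
  · intro z hz
    rw [hgn, hz, mul_zero, Real.sin_zero, mul_zero, mul_zero, neg_zero, Real.exp_zero, mul_one]
    have : Complex.exp z = (Real.exp z.re : ℂ) := by
      rw [Complex.ofReal_exp]
      congr 1
      exact Complex.ext rfl (by simpa using hz)
    rw [this]
    exact hR _ (Real.exp_pos _).le
  · intro z hz
    have h1 := hK _ (hre z (hz ▸ hφ0.le) hz.le) (him z (hz ▸ hφ0.le) hz.le)
    rw [hgn]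
    calc _ ≤ C * Real.exp (A * (Complex.exp z).re ^ 2) * _ := by gcongr
      _ = C := by
        rw [mul_assoc, ← Real.exp_add, Complex.exp_re, hz, mul_pow, ← Real.exp_nat_mul,
          Real.sin_two_mul, hc]
        have : A * (Real.exp ((2 : ℕ) * z.re) * Real.cos φ ^ 2) + -(A * Real.cos φ /
            (2 * Real.sin φ) * (Real.exp (2 * z.re) * (2 * Real.sin φ * Real.cos φ))) = 0 := by
          push_cast
          field_simp
          ring
        rw [this, Real.exp_zero, mul_one]

/-- A Phragmén–Lindelöf principle in a quadrant at the critical order `2`. -/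
lemma norm_le_of_quadrant {K : ℂ → ℂ} (hd : ∀ z : ℂ, 0 ≤ z.im → DifferentiableAt ℂ K z)
    {A C : ℝ} (hA : 0 ≤ A) (hC : 0 ≤ C)
    (hK : ∀ z : ℂ, 0 ≤ z.re → 0 ≤ z.im → ‖K z‖ ≤ C * Real.exp (A * z.re ^ 2))
    (hR : ∀ x : ℝ, 0 ≤ x → ‖K x‖ ≤ C) {z : ℂ} (hre : 0 ≤ z.re) (him : 0 ≤ z.im) :
    ‖K z‖ ≤ C := by
  rcases hre.eq_or_lt with h | h
  · simpa [← h] using hK z hre him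
  have hz : z ≠ 0 := by rintro rfl; simp at h
  have harg0 : 0 ≤ (Complex.log z).im := by simpa [Complex.log_im] using him
  have harg : (Complex.log z).im < Real.pi / 2 := by
    rw [Complex.log_im]
    exact (abs_lt.mp (Complex.abs_arg_lt_pi_div_two_iff.mpr (Or.inl h))).2
  rw [← Complex.exp_log hz]
  set w := Complex.log z
  -- As the opening tends to `π / 2`, `cos φ → 0` and the correcting factor tends to `1`.
  have hlim : Filter.Tendsto (fun φ : ℝ => ‖K (Complex.exp w)‖ *
      Real.exp (-(A * Real.cos φ / (2 * Real.sin φ) *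
      (Real.exp (2 * w.re) * Real.sin (2 * w.im))))) (nhdsWithin (Real.pi / 2)
        (Set.Iio (Real.pi / 2))) (nhds ‖K (Complex.exp w)‖) := by
    have hcont : ContinuousAt (fun φ : ℝ => ‖K (Complex.exp w)‖ *
      Real.exp (-(A * Real.cos φ / (2 * Real.sin φ) *
      (Real.exp (2 * w.re) * Real.sin (2 * w.im))))) (Real.pi / 2) := by
      have : 2 * Real.sin (Real.pi / 2) ≠ 0 := by simp
      fun_prop (disch := assumption)
    have := hcont.tendsto.mono_left (nhdsWithin_le_nhds (s := Set.Iio (Real.pi / 2)))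
    simpa using this
  refine le_of_tendsto hlim ?_
  filter_upwards [Ioo_mem_nhdsLT harg] with φ hφ
  exact norm_mul_exp_le_of_sector hd hA hC hK hR hφ.2 harg0 hφ.1

/-- Dividing by `(z + i) ^ n`, which has no zero in the closed upper half-plane, removes the
polynomial factor. The `2 ^ n` comes from `1 + |x| ≤ 2 |x + i|` on the real axis. -/
lemma norm_le_of_quadrant_of_growth {H : ℂ → ℂ} (hH : Differentiable ℂ H) {A D : ℝ} (hA : 0 ≤ A)
    (hD : 0 ≤ D) (n : ℕ) (h : ∀ z : ℂ, ‖H z‖ ≤ D * (1 + |z.im|) ^ n * Real.exp (A * z.re ^ 2))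
    (hR : ∀ x : ℝ, ‖H x‖ ≤ D * (1 + |x|) ^ n) {z : ℂ} (hre : 0 ≤ z.re) (him : 0 ≤ z.im) :
    ‖H z‖ ≤ D * 2 ^ n * (1 + ‖z‖) ^ n := by
  have hne : ∀ z : ℂ, 0 ≤ z.im → z + Complex.I ≠ 0 := fun z hz h0 => by
    have := congrArg Complex.im h0
    simp at this
    linarith
  have hpos : ∀ z : ℂ, 0 ≤ z.im → 0 < ‖z + Complex.I‖ := fun z hz => norm_pos_iff.mpr (hne z hz)
  have hni : ∀ z : ℂ, 0 ≤ z.im → 1 + |z.im| ≤ ‖z + Complex.I‖ := fun z hz => by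
    have := Complex.abs_im_le_norm (z + Complex.I)
    rw [Complex.add_im, Complex.I_im] at this
    rw [abs_of_nonneg hz]
    linarith [le_abs_self (z.im + 1)]
  have key := norm_le_of_quadrant (K := fun z => H z / (z + Complex.I) ^ n) (A := A)
    (C := D * 2 ^ n) (fun z hz => hH.differentiableAt.div (by fun_prop) (pow_ne_zero _ (hne z hz)))
    hA (by positivity) (fun z hr hi => ?_) (fun x hx => ?_) hre him
  · rw [norm_div, norm_pow, div_le_iff₀ (pow_pos (hpos z him) n)] at key
    refine key.trans ?_
    gcongr
    exact (norm_add_le _ _).trans (by simp [add_comm])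
  · rw [norm_div, norm_pow, div_le_iff₀ (pow_pos (hpos z hi) n)]
    have h2 : (1 : ℝ) ≤ 2 ^ n := one_le_pow₀ (by norm_num)
    calc _ ≤ D * (1 + |z.im|) ^ n * Real.exp (A * z.re ^ 2) := h z
      _ ≤ D * ‖z + Complex.I‖ ^ n * Real.exp (A * z.re ^ 2) := by
        gcongr
        exact hni z hi
      _ = D * 1 * Real.exp (A * z.re ^ 2) * ‖z + Complex.I‖ ^ n := by ring
      _ ≤ _ := by gcongr
  · have h0 : (0 : ℝ) ≤ (x : ℂ).im := by simp
    rw [norm_div, norm_pow, div_le_iff₀ (pow_pos (hpos _ h0) n)]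
    refine (hR x).trans ?_
    rw [mul_assoc, ← mul_pow]
    gcongr
    have h1 := hni x h0
    have h2 := Complex.abs_re_le_norm ((x : ℂ) + Complex.I)
    simp only [Complex.ofReal_im, abs_zero, add_zero, Complex.add_re, Complex.ofReal_re,
      Complex.I_re] at h1 h2
    linarith

/-- An entire function bounded by `(1 + |im z|)ⁿ exp (A (re z)²)` and, on the real line, by a
polynomial of degree `n`, has polynomial growth. -/
lemma norm_le_of_growth {H : ℂ → ℂ} (hH : Differentiable ℂ H) {A D : ℝ} (hA : 0 ≤ A)
    (hD : 0 ≤ D) (n : ℕ) (h : ∀ z : ℂ, ‖H z‖ ≤ D * (1 + |z.im|) ^ n * Real.exp (A * z.re ^ 2))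
    (hR : ∀ x : ℝ, ‖H x‖ ≤ D * (1 + |x|) ^ n) (z : ℂ) :
    ‖H z‖ ≤ D * 2 ^ n * (1 + ‖z‖) ^ n := by
  -- The bounds are invariant under negation and conjugation of the variable, so the first quadrant
  -- suffices.
  have hconj : ∀ {G : ℂ → ℂ}, Differentiable ℂ G → Differentiable ℂ fun z => conj (G (conj z)) :=
    fun hG z => by simpa only [Complex.conj_conj, Function.comp_def] using (hG (conj z)).conj_conj
  have hneg : ∀ {G : ℂ → ℂ}, Differentiable ℂ G → Differentiable ℂ fun z => G (-z) :=
    fun hG => hG.comp differentiable_neg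
  rcases le_total 0 z.re with hr | hr <;> rcases le_total 0 z.im with hi | hi
  · exact norm_le_of_quadrant_of_growth hH hA hD n h hR hr hi
  · have := norm_le_of_quadrant_of_growth (hconj hH) hA hD n
      (fun z => by simpa using h (conj z)) (fun x => by simpa using hR x)
      (z := conj z) (by simpa using hr) (by simpa using hi)
    simpa using this
  · have := norm_le_of_quadrant_of_growth (hconj (hneg hH)) hA hD n
      (fun z => by simpa using h (-conj z)) (fun x => by simpa using hR (-x))
      (z := -conj z) (by simpa using hr) (by simpa using hi)
    simpa using this
  · have := norm_le_of_quadrant_of_growth (hneg hH) hA hD n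
      (fun z => by simpa using h (-z)) (fun x => by simpa using hR (-x))
      (z := -z) (by simpa using hr) (by simpa using hi)
    simpa using this

/-! ### Division by a real-rooted polynomial -/

/-- An entire function of polynomial growth dominated on the real line by a polynomial of the
same order with only real zeros is a multiple of that polynomial. -/
lemma exists_eq_const_mul_prod (s : Multiset ℂ) (hs : ∀ r ∈ s, r.im = 0) {H : ℂ → ℂ}
    (hH : Differentiable ℂ H) {C D : ℝ}
    (hR : ∀ x : ℝ, ‖H x‖ ≤ C * ‖(s.map fun r => (x : ℂ) - r).prod‖)
    (hG : ∀ z, ‖H z‖ ≤ D * (1 + ‖z‖) ^ s.card) :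
    ∃ k : ℂ, ∀ z, H z = k * (s.map fun r => z - r).prod := by
  induction s using Multiset.induction_on generalizing H D with
  | empty =>
    obtain ⟨k, hk⟩ := hH.exists_eq_const_of_bounded
      (isBounded_iff_forall_norm_le.mpr ⟨D, by rintro _ ⟨z, rfl⟩; simpa using hG z⟩)
    exact ⟨k, fun z => by simp [hk]⟩
  | cons r s ih =>
    have hr : ((r.re : ℝ) : ℂ) = r := Complex.ext rfl (by simp [hs r (by simp)])
    have hHr : H r = 0 := by
      have := hR r.re
      rw [hr] at this
      simpa using this
    set L := dslope H r with hL
    have hLd : Differentiable ℂ L := by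
      rw [← differentiableOn_univ]
      exact (Complex.differentiableOn_dslope Filter.univ_mem).mpr hH.differentiableOn
    have hHL : ∀ z, H z = (z - r) * L z := fun z => by
      have := sub_smul_dslope H r z
      rw [hHr, sub_zero, smul_eq_mul] at this
      exact this.symm
    have hD : 0 ≤ D := by
      have := (norm_nonneg _).trans (hG 0)
      simpa using this
    -- Cancelling `x - r` is legitimate only off `r`; density extends the inequality to `r`, which
    -- matters when the root is repeated.
    have hLR : ∀ x : ℝ, ‖L x‖ ≤ C * ‖(s.map fun r => (x : ℂ) - r).prod‖ := by
      have hcl : IsClosed {x : ℝ | ‖L x‖ ≤ C * ‖(s.map fun r => (x : ℂ) - r).prod‖} := by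
        refine isClosed_le ?_ ?_
        · exact (hLd.continuous.comp Complex.continuous_ofReal).norm
        · exact (continuous_const.mul (continuous_multiset_prod _ fun r _ => by fun_prop).norm)
      intro x
      have hsub : ({r.re}ᶜ : Set ℝ) ⊆
          {x : ℝ | ‖L x‖ ≤ C * ‖(s.map fun r => (x : ℂ) - r).prod‖} := by
        intro x hx
        have h1 := hR x
        rw [hHL, Multiset.map_cons, Multiset.prod_cons, norm_mul, norm_mul] at h1
        have h2 : 0 < ‖(x : ℂ) - r‖ := by
          rw [norm_pos_iff, sub_ne_zero, ← hr]
          exact_mod_cast hx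
        refine le_of_mul_le_mul_left (h1.trans_eq ?_) h2
        ring
      exact hcl.closure_subset_iff.mpr hsub ((dense_compl_singleton r.re).closure_eq ▸ trivial)
    -- Outside this ball `1 + |z| ≤ 2 |z - r|`, so dividing lowers the growth degree by one; inside,
    -- compactness gives the bound.
    obtain ⟨M, hM⟩ := (isCompact_closedBall (0 : ℂ) (2 * ‖r‖ + 1)).exists_bound_of_continuousOn
      hLd.continuous.continuousOn
    have hM0 : 0 ≤ M := (norm_nonneg _).trans (hM 0 (by simp; positivity))
    obtain ⟨k, hk⟩ := ih (fun a ha => hs a (by simp [ha])) hLd (D := 2 * D + M) hLR fun z => by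
      rcases le_total ‖z‖ (2 * ‖r‖ + 1) with hz | hz
      · calc ‖L z‖ ≤ M := hM z (by simpa using hz)
          _ = M * 1 := (mul_one M).symm
          _ ≤ (2 * D + M) * (1 + ‖z‖) ^ s.card := by
            gcongr
            · linarith
            · exact one_le_pow₀ (by linarith [norm_nonneg z])
      · have h1 := hG z
        rw [hHL, norm_mul, Multiset.card_cons, pow_succ] at h1
        have h2 : (1 + ‖z‖) ≤ 2 * ‖z - r‖ := by
          have := norm_sub_norm_le z r
          linarith
        have h3 : 0 < ‖z - r‖ := by linarith [norm_nonneg z]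
        refine le_of_mul_le_mul_left (h1.trans ?_) h3
        calc _ ≤ D * ((1 + ‖z‖) ^ s.card * (2 * ‖z - r‖)) := by gcongr
          _ = ‖z - r‖ * (2 * D * (1 + ‖z‖) ^ s.card) := by ring
          _ ≤ _ := by gcongr; linarith
    exact ⟨k, fun z => by rw [hHL, hk]; simp; ring⟩

lemma exists_norm_eval_le_pow (P : ℂ[X]) :
    ∃ D : ℝ, 0 ≤ D ∧ ∀ z : ℂ, ‖P.eval z‖ ≤ D * (1 + ‖z‖) ^ P.natDegree := by
  refine ⟨∑ i ∈ Finset.range (P.natDegree + 1), ‖P.coeff i‖, by positivity, fun z => ?_⟩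
  rw [eval_eq_sum_range, Finset.sum_mul]
  refine (norm_sum_le _ _).trans (Finset.sum_le_sum fun i hi => ?_)
  rw [norm_mul, norm_pow]
  gcongr
  calc ‖z‖ ^ i ≤ (1 + ‖z‖) ^ i := by gcongr; linarith
    _ ≤ _ := pow_le_pow_right₀ (by linarith [norm_nonneg z])
      (by simpa [Nat.lt_succ_iff] using hi)

/-! ### Entire Fourier transforms and the Hardy-type rigidity theorem -/

/-- The entire extension of the Fourier transform. -/
def entireFourier (u : ℝ → ℂ) (z : ℂ) : ℂ :=
  ∫ v : ℝ, Complex.exp (-2 * Real.pi * Complex.I * z * v) * u v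

lemma entireFourier_ofReal (u : ℝ → ℂ) (x : ℝ) : entireFourier u x = 𝓕 u x :=
  (fourier_eq_integral_exp_mul u x).symm

lemma norm_exp_fourier (z : ℂ) (v : ℝ) :
    ‖Complex.exp (-2 * Real.pi * Complex.I * z * v)‖ = Real.exp (2 * Real.pi * z.im * v) := by
  rw [Complex.norm_exp]
  congr 1
  simp

lemma two_pi_mul_mul_le (y v : ℝ) : 2 * Real.pi * y * v ≤ 2 * Real.pi * |y| * |v| := by
  rw [mul_assoc, mul_assoc _ |y|, ← abs_mul]
  gcongr
  exact le_abs_self _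

lemma exp_mul_abs_mul_gaussian_le {a c : ℝ} (hc : 0 < c) (v : ℝ) :
    Real.exp (a * |v|) * Real.exp (-c * v ^ 2) ≤
      Real.exp (a ^ 2 / (2 * c)) * Real.exp (-(c / 2) * v ^ 2) := by
  rw [← Real.exp_add, ← Real.exp_add, Real.exp_le_exp]
  have : a ^ 2 / (2 * c) + -(c / 2) * v ^ 2 - (a * |v| + -c * v ^ 2) =
      (a - c * |v|) ^ 2 / (2 * c) := by
    rw [← sq_abs v]; field_simp; ring
  have h2 : 0 ≤ (a - c * |v|) ^ 2 / (2 * c) := by positivity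
  linarith

lemma integrable_exp_fourier_mul {u : ℝ → ℂ} (hu : Continuous u) {B c : ℝ} (hc : 0 < c)
    (h : ∀ v, ‖u v‖ ≤ B * Real.exp (-c * v ^ 2)) (z : ℂ) :
    Integrable fun v : ℝ => Complex.exp (-2 * Real.pi * Complex.I * z * v) * u v := by
  have hB : 0 ≤ B := by simpa using (norm_nonneg _).trans (h 0)
  refine integrable_of_norm_le_gaussian (c := c / 2)
    (C := B * Real.exp ((2 * Real.pi * |z.im|) ^ 2 / (2 * c))) (by fun_prop) (by positivity)
    fun v => ?_
  rw [norm_mul, norm_exp_fourier]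
  calc _ ≤ Real.exp (2 * Real.pi * |z.im| * |v|) * (B * Real.exp (-c * v ^ 2)) := by
        exact mul_le_mul (Real.exp_le_exp.mpr (two_pi_mul_mul_le _ _)) (h v) (norm_nonneg _)
          (Real.exp_pos _).le
    _ = B * (Real.exp (2 * Real.pi * |z.im| * |v|) * Real.exp (-c * v ^ 2)) := by ring
    _ ≤ _ := by
      rw [mul_assoc B]
      exact mul_le_mul_of_nonneg_left (exp_mul_abs_mul_gaussian_le hc v) hB

lemma differentiable_entireFourier {u : ℝ → ℂ} (hu : Continuous u) {B c : ℝ} (hc : 0 < c)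
    (h : ∀ v, ‖u v‖ ≤ B * Real.exp (-c * v ^ 2)) : Differentiable ℂ (entireFourier u) := by
  have hB : 0 ≤ B := by simpa using (norm_nonneg _).trans (h 0)
  intro z₀
  -- The final `+ 1` absorbs the factor `|v| ≤ exp |v|` produced by differentiating.
  set a : ℝ := 2 * Real.pi * (‖z₀‖ + 1) + 1 with ha
  refine (hasDerivAt_integral_of_dominated_loc_of_deriv_le
    (F' := fun z v => (-2 * Real.pi * Complex.I * v) *
      (Complex.exp (-2 * Real.pi * Complex.I * z * v) * u v))
    (bound := fun v => 2 * Real.pi * B * Real.exp (a ^ 2 / (2 * c)) *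
      Real.exp (-(c / 2) * v ^ 2))
    (Metric.ball_mem_nhds z₀ one_pos) (Filter.Eventually.of_forall fun z => ?_)
    (integrable_exp_fourier_mul hu hc h z₀) ?_ (Filter.Eventually.of_forall fun v z hz => ?_)
    ?_ (Filter.Eventually.of_forall fun v z _ => ?_)).2.differentiableAt
  · exact (integrable_exp_fourier_mul hu hc h z).aestronglyMeasurable
  · exact Continuous.aestronglyMeasurable (by fun_prop)
  · have him : |z.im| ≤ ‖z₀‖ + 1 := by
      have h1 := Complex.abs_im_le_norm z
      have h2 := norm_sub_norm_le z z₀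
      rw [mem_ball_iff_norm] at hz
      linarith
    have hv : |v| ≤ Real.exp |v| := by linarith [Real.add_one_le_exp |v|]
    have hn : ‖(-2 * Real.pi * Complex.I * v : ℂ)‖ = 2 * Real.pi * |v| := by
      simp [abs_of_pos Real.pi_pos]
    rw [norm_mul, hn, norm_mul, norm_exp_fourier]
    calc _ ≤ 2 * Real.pi * Real.exp |v| * (Real.exp (2 * Real.pi * (‖z₀‖ + 1) * |v|) *
          (B * Real.exp (-c * v ^ 2))) := by
          refine mul_le_mul (mul_le_mul_of_nonneg_left hv (by positivity)) (mul_le_mul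
            (Real.exp_le_exp.mpr ((two_pi_mul_mul_le _ _).trans ?_)) (h v) (norm_nonneg _)
            (Real.exp_pos _).le) (by positivity) (by positivity)
          gcongr
      _ = 2 * Real.pi * B * (Real.exp (a * |v|) * Real.exp (-c * v ^ 2)) := by
        rw [show a * |v| = |v| + 2 * Real.pi * (‖z₀‖ + 1) * |v| by rw [ha]; ring, Real.exp_add]
        ring
      _ ≤ _ := by
        rw [mul_assoc (2 * Real.pi * B)]
        exact mul_le_mul_of_nonneg_left (exp_mul_abs_mul_gaussian_le hc v) (by positivity)
  · exact (integrable_exp_neg_mul_sq (by positivity)).const_mul _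
  · have h1 : HasDerivAt (fun z : ℂ => -2 * Real.pi * Complex.I * z * v)
        (-2 * Real.pi * Complex.I * v) z := by
      have := ((hasDerivAt_id z).const_mul (-2 * Real.pi * Complex.I : ℂ)).mul_const (v : ℂ)
      simpa using this
    exact (h1.cexp.mul_const (u v)).congr_deriv (by ring)

/-- The modulus of the Fourier kernel depends only on `im z`, so the majorant's transform on the
imaginary axis controls whole horizontal lines. -/
lemma norm_entireFourier_le {u : ℝ → ℂ} {v : ℝ → ℝ} (hv : Continuous v)
    (huv : ∀ x, ‖u x‖ ≤ v x) {B c : ℝ} (hc : 0 < c) (hB : ∀ x, v x ≤ B * Real.exp (-c * x ^ 2))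
    (z : ℂ) : ‖entireFourier u z‖ ≤ ‖entireFourier (fun x => (v x : ℂ)) (z.im * Complex.I)‖ := by
  have hv0 : ∀ x, 0 ≤ v x := fun x => (norm_nonneg _).trans (huv x)
  have hexp : ∀ x : ℝ, Complex.exp (-2 * Real.pi * Complex.I * (z.im * Complex.I) * x) * (v x : ℂ) =
      ((Real.exp (2 * Real.pi * z.im * x) * v x : ℝ) : ℂ) := by
    intro x
    push_cast
    congr 2
    linear_combination (-2 * Real.pi * z.im * x : ℂ) * Complex.I_sq
  have hint : Integrable fun x : ℝ => Real.exp (2 * Real.pi * z.im * x) * v x := by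
    have := (integrable_exp_fourier_mul (u := fun x => (v x : ℂ)) (by fun_prop) hc
      (fun x => by rw [Complex.norm_real, Real.norm_of_nonneg (hv0 x)]; exact hB x)
      (z.im * Complex.I)).re
    refine this.congr (Filter.Eventually.of_forall fun x => ?_)
    dsimp only
    rw [hexp]
    exact Complex.ofReal_re _
  have h1 : entireFourier (fun x => (v x : ℂ)) (z.im * Complex.I) =
      ((∫ x : ℝ, Real.exp (2 * Real.pi * z.im * x) * v x : ℝ) : ℂ) := by
    rw [entireFourier, ← integral_complex_ofReal]
    exact integral_congr_ae (Filter.Eventually.of_forall hexp)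
  rw [h1, Complex.norm_real]
  refine le_trans ?_ (le_abs_self _)
  refine norm_integral_le_of_norm_le hint (Filter.Eventually.of_forall fun x => ?_)
  rw [norm_mul, norm_exp_fourier]
  gcongr
  exact huv x

/-- A form of Hardy's uncertainty principle: if `|u| ≤ v`, the Fourier transform of `v` is a
polynomial with only real zeros times a Gaussian, and it dominates the Fourier transform of `u`,
then the two transforms are proportional. -/
theorem exists_fourier_eq_const_mul {u : ℝ → ℂ} {v : ℝ → ℝ} (hu : Continuous u)
    (hv : Continuous v) (huv : ∀ x, ‖u x‖ ≤ v x) {B c : ℝ} (hc : 0 < c)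
    (hB : ∀ x, v x ≤ B * Real.exp (-c * x ^ 2)) {P : ℂ[X]} {lam : ℝ} (hlam : 0 < lam)
    (hP : ∀ z, P.IsRoot z → z.im = 0) (hP0 : P ≠ 0)
    (hvP : fourierHat v = polyGauss P lam) (h : ∀ x, ‖𝓕 u x‖ ≤ ‖fourierHat v x‖) :
    ∃ k : ℂ, ∀ x, 𝓕 u x = k * fourierHat v x := by
  have hv0 : ∀ x, 0 ≤ v x := fun x => (norm_nonneg _).trans (huv x)
  have hEu : Differentiable ℂ (entireFourier u) :=
    differentiable_entireFourier hu hc fun x => (huv x).trans (hB x)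
  have hEv : Differentiable ℂ (entireFourier fun x => (v x : ℂ)) :=
    differentiable_entireFourier (by fun_prop) hc
      fun x => by rw [Complex.norm_real, Real.norm_of_nonneg (hv0 x)]; exact hB x
  have hPd : Differentiable ℂ fun z => P.eval z := P.differentiable
  have hEvP : (entireFourier fun x => (v x : ℂ)) =
      fun z => P.eval z * Complex.exp (-(Real.pi * lam : ℝ) * z ^ 2) := by
    refine eq_of_eq_on_reals hEv (by fun_prop) fun x => ?_
    rw [entireFourier_ofReal]
    change fourierHat v x = _
    rw [hvP, polyGauss]
    push_cast
    congr 2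
    ring
  set A := Real.pi * lam with hA
  have hA0 : 0 < A := by positivity
  set H : ℂ → ℂ := fun z => entireFourier u z * Complex.exp (A * z ^ 2) with hH
  have hHd : Differentiable ℂ H := by fun_prop
  have hHx : ∀ x : ℝ, H x = 𝓕 u x * (Real.exp (A * x ^ 2) : ℂ) := fun x => by
    simp only [hH]
    rw [entireFourier_ofReal]
    push_cast
    rfl
  have hPx : ∀ x : ℝ, P.eval (x : ℂ) = fourierHat v x * (Real.exp (A * x ^ 2) : ℂ) := fun x => by
    rw [hvP, polyGauss, mul_assoc, ← Complex.ofReal_mul, ← Real.exp_add, hA]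
    ring_nf
    simp
  have hHR : ∀ x : ℝ, ‖H x‖ ≤ ‖P.eval (x : ℂ)‖ := fun x => by
    rw [hHx, hPx, norm_mul, norm_mul]
    gcongr
    exact h x
  obtain ⟨D, hD, hPD⟩ := exists_norm_eval_le_pow P
  -- At `iy` the transform of `v` is `P(iy) exp (A y²)`, while `exp (A z²)` has modulus `exp (A (x²
  -- - y²))`: the exponentials in `y` cancel.
  have hHz : ∀ z : ℂ, ‖H z‖ ≤ D * (1 + |z.im|) ^ P.natDegree * Real.exp (A * z.re ^ 2) := by
    intro z
    have h1 := norm_entireFourier_le hv huv hc hB z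
    rw [hEvP, norm_mul, Complex.norm_exp] at h1
    have h2 := hPD (z.im * Complex.I)
    rw [norm_mul, Complex.norm_I, mul_one, Complex.norm_real, Real.norm_eq_abs] at h2
    rw [hH, norm_mul, Complex.norm_exp]
    calc _ ≤ D * (1 + |z.im|) ^ P.natDegree *
          Real.exp ((-(A : ℂ) * (z.im * Complex.I) ^ 2).re) * Real.exp (((A : ℂ) * z ^ 2).re) := by
          gcongr
          refine h1.trans ?_
          gcongr
      _ = _ := by
        rw [mul_assoc, ← Real.exp_add]
        congr 2
        simp [pow_two]
        ring
  have hgrow := norm_le_of_growth hHd hA0.le hD P.natDegree hHz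
    fun x => (hHR x).trans (by simpa using hPD x)
  have hsplit := (IsAlgClosed.splits P)
  have hfac : ∀ z, P.eval z = P.leadingCoeff * (P.roots.map fun r => z - r).prod := fun z => by
    conv_lhs => rw [hsplit.eq_prod_roots]
    simp [eval_multiset_prod]
  have hcard : P.roots.card = P.natDegree := hsplit.natDegree_eq_card_roots.symm
  obtain ⟨k, hk⟩ := exists_eq_const_mul_prod P.roots
    (fun r hr => hP r (isRoot_of_mem_roots hr)) hHd (C := ‖P.leadingCoeff‖)
    (fun x => by rw [← norm_mul, ← hfac]; exact hHR x) (by rw [hcard]; exact hgrow)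
  have hl : P.leadingCoeff ≠ 0 := leadingCoeff_ne_zero.mpr hP0
  refine ⟨k / P.leadingCoeff, fun x => ?_⟩
  have h1 := hk x
  have h2 := hfac x
  rw [hHx] at h1
  rw [hPx] at h2
  have he : (Real.exp (A * x ^ 2) : ℂ) ≠ 0 := by exact_mod_cast (Real.exp_pos _).ne'
  refine mul_right_cancel₀ he ?_
  rw [h1, mul_assoc, h2]
  field_simp

/-! ### From rigidity to extremality -/

lemma fourier_fourier {f : ℝ → ℂ} (hc : Continuous f) (hi : Integrable f)
    (hF : Integrable (𝓕 f)) (x : ℝ) : 𝓕 (𝓕 f) x = f (-x) := by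
  have h := congrFun (hc.fourierInv_fourier_eq hi hF) (-x)
  rwa [Real.fourierInv_eq_fourier_neg, neg_neg] at h

lemma fourierHat_neg {f : ℝ → ℝ} (hf : ∀ x, f (-x) = f x) (x : ℝ) :
    fourierHat f (-x) = fourierHat f x := by
  rw [fourierHat, ← Real.fourierInv_eq_fourier_neg, Real.fourierInv_eq_fourier_comp_neg]
  simp only [hf]

lemma smul_mem_posCone {f : ℝ → ℝ} (hf : f ∈ posCone) {t : ℝ} (ht : 0 ≤ t) :
    t • f ∈ posCone :=
  ⟨hf.1.const_smul t, fun x => mul_nonneg ht (hf.2.1 x), hf.2.2.const_mul ht⟩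

/-- Extremality means that the only decompositions inside the cone are the proportional ones. -/
lemma isExtremal_of_forall_add {f : ℝ → ℝ} (hf : f ∈ posCone) (hf0 : f ≠ 0)
    (h : ∀ g ∈ posCone, ∀ g' ∈ posCone, g + g' = f → ∃ k : ℂ, ∀ x, (g x : ℂ) = k * f x) :
    IsExtremal f := by
  refine ⟨hf, hf0, Set.ext fun g => ⟨?_, ?_⟩⟩
  · rintro ⟨hg, g', hg', hgg⟩
    obtain ⟨k, hk⟩ := h g hg g' hg' (by rw [hgg]; simp)
    have hk' : ∀ x, g x = k.re * f x := fun x => by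
      have := congrArg Complex.re (hk x)
      rwa [Complex.ofReal_re, Complex.re_mul_ofReal] at this
    obtain ⟨x, hx⟩ := Function.ne_iff.mp hf0
    have hx0 : 0 < f x := lt_of_le_of_ne (hf.2.1 x) (Ne.symm hx)
    have h1 := hg.2.1 x
    have h2 : g x ≤ f x := by
      have := hg'.2.1 x
      rw [hgg, Pi.sub_apply]
      linarith
    rw [hk'] at h1 h2
    exact ⟨k.re, nonneg_of_mul_nonneg_left h1 hx0, le_of_mul_le_mul_right (by linarith) hx0,
      funext hk'⟩
  · rintro ⟨t, ht0, ht1, rfl⟩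
    refine ⟨smul_mem_posCone hf ht0, (1 - t) • f, smul_mem_posCone hf (by linarith), ?_⟩
    rw [sub_smul, one_smul, sub_sub_cancel]

lemma integrable_of_le_gaussian {f : ℝ → ℝ} (hf : f ∈ posCone) {B c : ℝ} (hc : 0 < c)
    (hB : ∀ x, f x ≤ B * Real.exp (-c * x ^ 2)) : Integrable f :=
  ((integrable_exp_neg_mul_sq hc).const_mul B).mono' hf.1.aestronglyMeasurable
    (Filter.Eventually.of_forall fun x => by rw [Real.norm_of_nonneg (hf.2.1 x)]; exact hB x)

lemma fourierHat_nonneg_of_le_gaussian {f : ℝ → ℝ} (hf : f ∈ posCone) {B c : ℝ} (hc : 0 < c)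
    (hB : ∀ x, f x ≤ B * Real.exp (-c * x ^ 2)) (ξ : ℝ) : 0 ≤ fourierHat f ξ := by
  have hB0 : 0 ≤ B := by simpa using (hf.2.1 0).trans (hB 0)
  refine hf.2.2.fourierHat_nonneg hf.1 (integrable_of_le_gaussian hf hc hB) (B := B)
    (fun x => ?_) ξ
  rw [abs_of_nonneg (hf.2.1 x)]
  refine (hB x).trans (mul_le_of_le_one_right hB0 (Real.exp_le_one_iff.mpr ?_))
  nlinarith [sq_nonneg x]

/-- Both summands inherit the Gaussian bound, so their transforms are non-negative: the
decomposition is an order relation on the Fourier side too. -/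
lemma norm_fourierHat_le_of_add {f g g' : ℝ → ℝ} (hg : g ∈ posCone) (hg' : g' ∈ posCone)
    (hadd : g + g' = f) {B c : ℝ} (hc : 0 < c)
    (hB : ∀ x, f x ≤ B * Real.exp (-c * x ^ 2)) (ξ : ℝ) :
    ‖fourierHat g ξ‖ ≤ (fourierHat f ξ).re := by
  have hgB : ∀ x, g x ≤ B * Real.exp (-c * x ^ 2) := fun x => by
    have := hB x
    rw [← hadd, Pi.add_apply] at this
    linarith [hg'.2.1 x]
  have hgB' : ∀ x, g' x ≤ B * Real.exp (-c * x ^ 2) := fun x => by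
    have := hB x
    rw [← hadd, Pi.add_apply] at this
    linarith [hg.2.1 x]
  have h0 := fourierHat_nonneg_of_le_gaussian hg hc hgB ξ
  have h1 := fourierHat_nonneg_of_le_gaussian hg' hc hgB' ξ
  have h2 : fourierHat f = fourierHat g + fourierHat g' := by
    refine Eq.trans ?_ (fourier_add (integrable_of_le_gaussian hg hc hgB).ofReal
      (integrable_of_le_gaussian hg' hc hgB').ofReal)
    rw [fourierHat, ← hadd]
    congr 1
    ext x
    simp
  have h3 : ‖fourierHat g ξ‖ = (fourierHat g ξ).re := by
    have := congrArg Complex.re (Complex.norm_of_nonneg' h0)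
    rwa [Complex.ofReal_re] at this
  rw [h2, Pi.add_apply, Complex.add_re, h3]
  linarith [(Complex.nonneg_iff.mp h1).1]

lemma exists_hermiteFun_le_gaussian (P : ℝ[X]) {lam : ℝ} (hlam : 0 < lam) :
    ∃ B c : ℝ, 0 < c ∧ ∀ x, hermiteFun P lam x ≤ B * Real.exp (-c * x ^ 2) := by
  obtain ⟨B, -, h⟩ := exists_norm_polyGauss_le (P.map Complex.ofRealHom) hlam
  refine ⟨B, _, (by positivity : 0 < Real.pi * lam / 2), fun x => ?_⟩
  have := h x
  rw [← ofReal_hermiteFun, Complex.norm_real] at this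
  exact (le_abs_self _).trans this

lemma polyGauss_eq_zero_iff {P : ℂ[X]} {lam : ℝ} : polyGauss P lam = 0 ↔ P = 0 := by
  refine ⟨fun h => ?_, fun h => by ext x; simp [h, polyGauss]⟩
  refine eq_zero_of_infinite_isRoot P
    ((Set.infinite_range_of_injective Complex.ofReal_injective).mono ?_)
  rintro _ ⟨x, rfl⟩
  have := congrFun h x
  rw [polyGauss] at this
  exact (mul_eq_zero.mp this).resolve_right (by exact_mod_cast (Real.exp_pos _).ne')

lemma hermiteFun_eq_zero_iff {P : ℝ[X]} {lam : ℝ} : hermiteFun P lam = 0 ↔ P = 0 := by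
  rw [← Polynomial.map_eq_zero_iff (f := Complex.ofRealHom) Complex.ofReal_injective,
    ← polyGauss_eq_zero_iff (lam := lam)]
  simp [funext_iff, ← ofReal_hermiteFun]

/-- A Hermite function of the cone with only real zeros is extremal. -/
theorem isExtremal_of_real_zeros {P : ℝ[X]} {lam : ℝ} (hlam : 0 < lam)
    (hf : hermiteFun P lam ∈ posCone) (hP0 : P ≠ 0)
    (hP : ∀ z, (P.map Complex.ofRealHom).IsRoot z → z.im = 0) :
    IsExtremal (hermiteFun P lam) := by
  obtain ⟨B, c, hc, hB⟩ := exists_hermiteFun_le_gaussian P hlam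
  obtain ⟨Q, -, hQ⟩ := exists_fourier_polyGauss (P.map Complex.ofRealHom) hlam
  set f := hermiteFun P lam with hfdef
  have hfC : (fun x => (f x : ℂ)) = polyGauss (P.map Complex.ofRealHom) lam :=
    funext fun x => ofReal_hermiteFun P lam x
  have hfQ : fourierHat f = polyGauss Q lam⁻¹ := by rw [fourierHat, hfC, hQ]
  have hlam' : 0 < lam⁻¹ := inv_pos.mpr hlam
  obtain ⟨B', -, hB'⟩ := exists_norm_polyGauss_le Q hlam'
  have hfi := integrable_of_le_gaussian hf hc hB
  have hfhat := fourierHat_nonneg_of_le_gaussian hf hc hB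
  have hFi : Integrable (fourierHat f) := hfQ ▸ integrable_polyGauss Q hlam'
  have hff : ∀ x, 𝓕 (fourierHat f) x = f x := fun x => by
    rw [← hf.2.2.even x]
    exact fourier_fourier (Complex.continuous_ofReal.comp hf.1) hfi.ofReal hFi x
  have hvf : (fun x => (((fourierHat f x).re : ℝ) : ℂ)) = fourierHat f :=
    funext fun x => (Complex.eq_re_of_ofReal_le (hfhat x)).symm
  refine isExtremal_of_forall_add hf (fun h => hP0 (hermiteFun_eq_zero_iff.mp h))
    fun g hg g' hg' hadd => ?_
  have hgf : ∀ x, g x ≤ f x := fun x => by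
    rw [← hadd, Pi.add_apply]
    linarith [hg'.2.1 x]
  have hgi := integrable_of_le_gaussian hg hc fun x => (hgf x).trans (hB x)
  have huv := norm_fourierHat_le_of_add hg hg' hadd hc hB
  have hgc : Continuous (fourierHat g) := continuous_fourier hgi.ofReal
  have hgFi : Integrable (fourierHat g) := hFi.mono hgc.aestronglyMeasurable
    (Filter.Eventually.of_forall fun x => (huv x).trans (Complex.re_le_norm _))
  have hgg : ∀ x, 𝓕 (fourierHat g) x = g x := fun x => by
    rw [← hg.2.2.even x]
    exact fourier_fourier (Complex.continuous_ofReal.comp hg.1) hgi.ofReal hgFi x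
  have hv2 : fourierHat (fun x => (fourierHat f x).re) = fun x => (f x : ℂ) := by
    rw [fourierHat, hvf]
    exact funext hff
  -- Rigidity is applied to the transforms: everything is even, so transforming again returns `g`
  -- and `f`, and the real-rooted polynomial is that of `f`.
  obtain ⟨k, hk⟩ := exists_fourier_eq_const_mul (u := fourierHat g)
    (v := fun x => (fourierHat f x).re) hgc
    (Complex.continuous_re.comp (continuous_fourier hfi.ofReal)) huv
    (by positivity : 0 < Real.pi * lam⁻¹ / 2)
    (fun x => (Complex.re_le_norm _).trans (by rw [hfQ]; exact hB' x)) hlam hP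
    ((Polynomial.map_ne_zero_iff Complex.ofReal_injective).mpr hP0)
    (by rw [hv2, hfC])
    (fun x => by
      rw [hgg, hv2, Complex.norm_real, Complex.norm_real, Real.norm_of_nonneg (hg.2.1 x),
        Real.norm_of_nonneg (hf.2.1 x)]
      exact hgf x)
  exact ⟨k, fun x => by rw [← hgg, hk, hv2]⟩

/-- An element of the cone with Gaussian decay, whose Fourier transform is a Hermite function with
only real zeros, is extremal. -/
theorem isExtremal_of_fourierHat_real_zeros {f : ℝ → ℝ} (hf : f ∈ posCone) {B c : ℝ} (hc : 0 < c)
    (hB : ∀ x, f x ≤ B * Real.exp (-c * x ^ 2)) {P : ℂ[X]} {lam : ℝ} (hlam : 0 < lam)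
    (hfP : fourierHat f = polyGauss P lam) (hP0 : P ≠ 0) (hP : ∀ z, P.IsRoot z → z.im = 0) :
    IsExtremal f := by
  have hfi := integrable_of_le_gaussian hf hc hB
  have hFi : Integrable (fourierHat f) := hfP ▸ integrable_polyGauss P hlam
  have hff : ∀ x, 𝓕 (fourierHat f) x = f x := fun x => by
    rw [← hf.2.2.even x]
    exact fourier_fourier (Complex.continuous_ofReal.comp hf.1) hfi.ofReal hFi x
  have hf0 : f ≠ 0 := by
    rintro rfl
    refine hP0 (polyGauss_eq_zero_iff (lam := lam).mp ?_)
    rw [← hfP]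
    ext x
    simp [fourierHat, fourier_eq_integral_exp_mul]
  refine isExtremal_of_forall_add hf hf0 fun g hg g' hg' hadd => ?_
  have hgf : ∀ x, g x ≤ f x := fun x => by
    rw [← hadd, Pi.add_apply]
    linarith [hg'.2.1 x]
  have hgi := integrable_of_le_gaussian hg hc fun x => (hgf x).trans (hB x)
  have huv := norm_fourierHat_le_of_add hg hg' hadd hc hB
  have hgc : Continuous (fourierHat g) := continuous_fourier hgi.ofReal
  have hgFi : Integrable (fourierHat g) := hFi.mono hgc.aestronglyMeasurable
    (Filter.Eventually.of_forall fun x => (huv x).trans (Complex.re_le_norm _))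
  have hgg : ∀ x, 𝓕 (fourierHat g) x = g x := fun x => by
    rw [← hg.2.2.even x]
    exact fourier_fourier (Complex.continuous_ofReal.comp hg.1) hgi.ofReal hgFi x
  obtain ⟨k, hk⟩ := exists_fourier_eq_const_mul (u := fun x => (g x : ℂ)) (v := f)
    (Complex.continuous_ofReal.comp hg.1) hf.1
    (fun x => by rw [Complex.norm_real, Real.norm_of_nonneg (hg.2.1 x)]; exact hgf x) hc hB hlam
    hP hP0 hfP (fun x => (huv x).trans (Complex.re_le_norm _))
  have hk' : fourierHat g = k • fourierHat f := funext hk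
  exact ⟨k, fun x => by rw [← hgg, hk', fourier_const_smul, Pi.smul_apply, hff, smul_eq_mul]⟩

/-! ### The family `fab` and products -/

lemma im_eq_zero_of_hasOnlyRealZeros {P : ℂ[X]} {lam : ℝ}
    (h : HasOnlyRealZeros (polyGauss P lam)) (z : ℂ) (hz : P.IsRoot z) : z.im = 0 := by
  obtain ⟨G, hG, hGP, h0⟩ := h
  have hPd : Differentiable ℂ fun z => P.eval z := P.differentiable
  have : G = fun z => P.eval z * Complex.exp (-Real.pi * lam * z ^ 2) :=
    eq_of_eq_on_reals hG (by fun_prop) fun x => by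
      rw [hGP, polyGauss]
      push_cast
      rfl
  refine h0 z ?_
  rw [this]
  simp [hz.eq_zero]

/-- The polynomial factor of `f_{a,b}`. -/
def fabPoly (a b : ℝ) : ℝ[X] := H₀ + C (2 * a) * H₂ + C b * H₄

lemma fab_eq_hermiteFun (a b : ℝ) : fab a b = hermiteFun (fabPoly a b) 1 := rfl

lemma natDegree_fabPoly (a : ℝ) {b : ℝ} (hb : b ≠ 0) : (fabPoly a b).natDegree = 4 := by
  have h : fabPoly a b = C (16 * Real.pi ^ 2 * b) * X ^ 4 +
      C (8 * Real.pi * a - 24 * Real.pi * b) * X ^ 2 + C (1 - 2 * a + 3 * b) := by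
    simp only [fabPoly, H₀, H₂, H₄, map_mul, map_sub, map_add, map_pow, map_ofNat, map_one]
    ring
  have h0 : 16 * Real.pi ^ 2 * b ≠ 0 := by
    have := Real.pi_ne_zero
    positivity
  rw [h]
  compute_degree!

/-- The nested products by `X` match the iteration of `fourier_polyGauss_X_mul`. -/
lemma map_fabPoly (a b : ℝ) : (fabPoly a b).map Complex.ofRealHom =
    C ((1 - 2 * a + 3 * b : ℝ) : ℂ) * 1 +
      (C ((8 * Real.pi * a - 24 * Real.pi * b : ℝ) : ℂ) * (X * (X * 1)) +
        C ((16 * Real.pi ^ 2 * b : ℝ) : ℂ) * (X * (X * (X * (X * 1))))) := by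
  simp only [fabPoly, H₀, H₂, H₄, Polynomial.map_add, Polynomial.map_sub, Polynomial.map_mul,
    Polynomial.map_pow, map_C, map_X, Polynomial.map_one, Polynomial.map_ofNat,
    Complex.ofRealHom_eq_coe, Complex.ofReal_mul, Complex.ofReal_sub, Complex.ofReal_add,
    Complex.ofReal_pow, Complex.ofReal_ofNat, Complex.ofReal_one,
    map_mul, map_sub, map_add, map_pow, map_ofNat, map_one]
  ring

/-- The Hermite functions of degrees 0, 2, 4 are eigenfunctions of the Fourier transform with
eigenvalues `1, -1, 1`, so only the sign of `a` changes. -/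
lemma fourierHat_fab (a b : ℝ) : fourierHat (fab a b) = fun x => (fab (-a) b x : ℂ) := by
  have h0 : 𝓕 (polyGauss 1 1) = polyGauss 1 1⁻¹ := by
    simpa using fourier_polyGauss_one one_pos
  have h2 := fourier_polyGauss_X_mul one_pos (fourier_polyGauss_X_mul one_pos h0)
  have h4 := fourier_polyGauss_X_mul one_pos (fourier_polyGauss_X_mul one_pos h2)
  have hpi : (Real.pi : ℂ) ≠ 0 := by exact_mod_cast Real.pi_ne_zero
  have hf : (fun x => (fab a b x : ℂ)) = polyGauss ((fabPoly a b).map Complex.ofRealHom) 1 :=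
    funext fun x => ofReal_hermiteFun _ 1 x
  rw [fourierHat, hf, map_fabPoly, fourier_polyGauss_add _ _ one_pos,
    fourier_polyGauss_add _ _ one_pos, fourier_polyGauss_C_mul, fourier_polyGauss_C_mul,
    fourier_polyGauss_C_mul, h0, h2, h4]
  ext x
  rw [fab_eq_hermiteFun, ofReal_hermiteFun, map_fabPoly]
  simp only [polyGauss, Pi.add_apply, Pi.smul_apply, smul_eq_mul, eval_add, eval_sub, eval_mul,
    eval_C, eval_X, eval_one, derivative_mul, derivative_sub, derivative_C, derivative_X,
    derivative_one, inv_one, derivative_add, derivative_zero, eval_zero]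
  push_cast
  have hI4 : Complex.I ^ 4 = 1 := Complex.I_pow_four
  have hI2 : Complex.I ^ 2 = -1 := Complex.I_sq
  field_simp
  ring_nf
  simp only [hI4, hI2]
  ring

/-- Conjugating the coefficients preserves the values on the real line, hence the polynomial. -/
lemma exists_map_ofReal_eq {Q : ℂ[X]} (h : ∀ x : ℝ, (Q.eval (x : ℂ)).im = 0) :
    ∃ P : ℝ[X], P.map Complex.ofRealHom = Q := by
  rw [← mem_lifts, lifts_iff_coeff_lifts]
  have hQ : Q.map (starRingEnd ℂ) = Q := by
    refine eq_of_infinite_eval_eq _ _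
      ((Set.infinite_range_of_injective Complex.ofReal_injective).mono ?_)
    rintro _ ⟨x, rfl⟩
    have h1 := Polynomial.eval_map_apply (p := Q) (starRingEnd ℂ) (x : ℂ)
    rw [Complex.conj_ofReal] at h1
    rw [Set.mem_ofPred_eq, h1]
    exact Complex.conj_eq_iff_im.mpr (h x)
  intro n
  have h1 := congrArg (fun p => p.coeff n) hQ
  simp only [coeff_map] at h1
  obtain ⟨r, hr⟩ := Complex.conj_eq_iff_real.mp h1
  exact ⟨r, hr.symm⟩

lemma prod_fab_eq_hermiteFun {n : ℕ} (a b : Fin (n + 1) → ℝ) :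
    (fun x => ∏ i, fab (a i) (b i) x) =
      hermiteFun (∏ i, fabPoly (a i) (b i)) ((n : ℝ) + 1) := by
  ext x
  simp only [fab_eq_hermiteFun, hermiteFun, Finset.prod_mul_distrib, eval_prod,
    Finset.prod_const, Finset.card_univ, Fintype.card_fin, ← Real.exp_nat_mul]
  congr 2
  push_cast
  ring

lemma fab_neg_mem_posCone {a b : ℝ} (h : fab a b ∈ posCone) : fab (-a) b ∈ posCone := by
  obtain ⟨B, c, hc, hB⟩ := exists_hermiteFun_le_gaussian (fabPoly a b) one_pos
  refine ⟨continuous_hermiteFun _ _, fun x => ?_, ?_⟩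
  · have := fourierHat_nonneg_of_le_gaussian h hc hB x
    rw [fourierHat_fab] at this
    exact Complex.zero_le_real.mp this
  · exact isPositiveDefinite_of_fourierHat h.2.1 (integrable_hermiteFun _ one_pos)
      fun x => (congrFun (fourierHat_fab a b) x).symm

lemma prod_mem_posCone {ι : Type*} [Fintype ι] {f : ι → ℝ → ℝ} (hf : ∀ i, f i ∈ posCone) :
    (fun x => ∏ i, f i x) ∈ posCone :=
  ⟨continuous_finsetProd _ fun i _ => (hf i).1,
    fun x => Finset.prod_nonneg fun i _ => (hf i).2.1 x, .prod _ fun i _ => (hf i).2.2⟩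

lemma fabPoly_root_im_eq_zero {a b : ℝ} (h : HasOnlyRealZeros (fun x => (fab a b x : ℂ))) (z : ℂ)
    (hz : ((fabPoly a b).map Complex.ofRealHom).IsRoot z) : z.im = 0 := by
  refine im_eq_zero_of_hasOnlyRealZeros (lam := 1) ?_ z hz
  convert h using 1
  exact funext fun x => (ofReal_hermiteFun _ 1 x).symm

lemma prod_root_im_eq_zero {ι : Type*} [Fintype ι] {p : ι → ℝ[X]}
    (h : ∀ i, ∀ z, ((p i).map Complex.ofRealHom).IsRoot z → z.im = 0) (z : ℂ)
    (hz : ((∏ i, p i).map Complex.ofRealHom).IsRoot z) : z.im = 0 := by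
  rw [Polynomial.map_prod, IsRoot.def, eval_prod, Finset.prod_eq_zero_iff] at hz
  obtain ⟨i, -, hi⟩ := hz
  exact h i z hi

lemma natDegree_prod_fabPoly {n : ℕ} (a : Fin (n + 1) → ℝ) {b : Fin (n + 1) → ℝ}
    (hb : ∀ i, b i ≠ 0) : (∏ i, fabPoly (a i) (b i)).natDegree = 4 * (n + 1) := by
  have h4 : ∀ i, (fabPoly (a i) (b i)).natDegree = 4 := fun i => natDegree_fabPoly _ (hb i)
  rw [natDegree_prod _ _ fun i _ h0 => by simpa [h0] using h4 i]
  simp [h4, mul_comm]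

theorem isExtremal_prod_of_isTimeType {n : ℕ} {a b : Fin (n + 1) → ℝ}
    (h : ∀ i, IsTimeType (a i) (b i)) : IsExtremal (fun x => ∏ i, fab (a i) (b i) x) := by
  have hmem := prod_mem_posCone fun i => (h i).1.1
  rw [prod_fab_eq_hermiteFun] at hmem ⊢
  refine isExtremal_of_real_zeros (by positivity) hmem
    (Finset.prod_ne_zero_iff.mpr fun i _ h0 => (h i).1.2.1 ?_)
    (prod_root_im_eq_zero fun i => fabPoly_root_im_eq_zero (h i).2.1)
  rw [fab_eq_hermiteFun, h0, hermiteFun_eq_zero_iff]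

/-! ### Iterated convolutions -/

lemma ofReal_convolution (f g : ℝ → ℝ) :
    (fun x => ((convolution f g (ContinuousLinearMap.mul ℝ ℝ) volume x : ℝ) : ℂ)) =
      convolution (fun x => (f x : ℂ)) (fun x => (g x : ℂ)) (ContinuousLinearMap.mul ℂ ℂ)
        volume := by
  ext x
  rw [convolution_def, convolution_def, ← integral_complex_ofReal]
  simp

lemma continuous_integrable_fourierHat_iterConv (n : ℕ) (F : Fin (n + 1) → ℝ → ℝ)
    (hc : ∀ i, Continuous (F i)) (hi : ∀ i, Integrable (F i))
    (hb : ∀ i, BddAbove (Set.range fun x => ‖F i x‖)) :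
    Continuous (iterConv n F) ∧ Integrable (iterConv n F) ∧
      ∀ ξ, fourierHat (iterConv n F) ξ = ∏ i, fourierHat (F i) ξ := by
  induction n with
  | zero => exact ⟨hc 0, hi 0, fun ξ => by simp [iterConv]⟩
  | succ n ih =>
    obtain ⟨h1, h2, h3⟩ := ih (fun i => F i.castSucc) (fun i => hc _) (fun i => hi _)
      (fun i => hb _)
    refine ⟨(hb (Fin.last (n + 1))).continuous_convolution_right_of_integrable _ h2 (hc _),
      h2.integrable_convolution _ (hi _), fun ξ => ?_⟩
    rw [Fin.prod_univ_castSucc, ← h3, iterConv, fourierHat, ofReal_convolution]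
    exact Real.fourier_mul_convolution_eq h2.ofReal (hi _).ofReal ξ

/-- The first identity carries the real zeros. The second, by inversion and evenness, exhibits the
convolution as the transform of a member of the cone, giving positivity, positive definiteness and
the Hermite form. -/
lemma iterConv_fab_eq {n : ℕ} {a b : Fin (n + 1) → ℝ} (h : ∀ i, fab (a i) (b i) ∈ posCone) :
    fourierHat (iterConv n fun i => fab (a i) (b i)) =
      (fun x => ((∏ i, fab (-a i) (b i) x : ℝ) : ℂ)) ∧
    (fun x => (iterConv n (fun i => fab (a i) (b i)) x : ℂ)) =
      fourierHat fun x => ∏ i, fab (-a i) (b i) x := by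
  obtain ⟨hc, hi, hF⟩ := continuous_integrable_fourierHat_iterConv n
    (fun i => fab (a i) (b i)) (fun i => continuous_hermiteFun _ _)
    (fun i => integrable_hermiteFun _ one_pos) (fun i => by
      obtain ⟨B, hB, h⟩ := exists_norm_polyGauss_le
        ((fabPoly (a i) (b i)).map Complex.ofRealHom) one_pos
      refine ⟨B, ?_⟩
      rintro _ ⟨x, rfl⟩
      have h1 := h x
      rw [← ofReal_hermiteFun, Complex.norm_real] at h1
      refine h1.trans (mul_le_of_le_one_right hB (Real.exp_le_one_iff.mpr ?_))
      have : 0 ≤ Real.pi * 1 / 2 * x ^ 2 := by positivity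
      linarith)
  have h1 : fourierHat (iterConv n fun i => fab (a i) (b i)) =
      fun x => ((∏ i, fab (-a i) (b i) x : ℝ) : ℂ) := by
    ext ξ
    rw [hF]
    push_cast
    exact Finset.prod_congr rfl fun i _ => congrFun (fourierHat_fab _ _) ξ
  refine ⟨h1, ?_⟩
  have hev := (prod_mem_posCone fun i => fab_neg_mem_posCone (h i)).2.2.even
  have hqi : Integrable fun x => ∏ i, fab (-a i) (b i) x := by
    rw [prod_fab_eq_hermiteFun]
    exact integrable_hermiteFun _ (by positivity)
  ext x
  have h2 := fourier_fourier (Complex.continuous_ofReal.comp hc) hi.ofReal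
    (by
      change Integrable (fourierHat _)
      rw [h1]
      exact hqi.ofReal) (-x)
  rw [neg_neg] at h2
  rw [← fourierHat_neg hev, fourierHat, ← h1]
  exact h2.symm

theorem iterConv_of_isFrequencyType {n : ℕ} {a b : Fin (n + 1) → ℝ}
    (h : ∀ i, IsFrequencyType (a i) (b i)) :
    IsExtremal (iterConv n fun i => fab (a i) (b i)) ∧
      ((∀ i, b i ≠ 0) → ∃ P : ℝ[X], P.natDegree = 4 * (n + 1) ∧
        iterConv n (fun i => fab (a i) (b i)) = hermiteFun P (1 / ((n : ℝ) + 1))) := by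
  obtain ⟨h1, h2⟩ := iterConv_fab_eq fun i => (h i).1.1
  have hq := prod_mem_posCone fun i => fab_neg_mem_posCone (h i).1.1
  rw [prod_fab_eq_hermiteFun] at h2 hq
  have hn : (0 : ℝ) < (n : ℝ) + 1 := by positivity
  have h1' : fourierHat (iterConv n fun i => fab (a i) (b i)) =
      polyGauss ((∏ i, fabPoly (-a i) (b i)).map Complex.ofRealHom) ((n : ℝ) + 1) := by
    rw [h1]
    ext x
    rw [← ofReal_hermiteFun, ← prod_fab_eq_hermiteFun]
  obtain ⟨Q, hQd, hQ⟩ :=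
    exists_fourier_polyGauss ((∏ i, fabPoly (-a i) (b i)).map Complex.ofRealHom) hn
  have hconvQ : (fun x => (iterConv n (fun i => fab (a i) (b i)) x : ℂ)) =
      polyGauss Q ((n : ℝ) + 1)⁻¹ := by
    rw [h2, fourierHat, ← hQ]
    congr 1
    exact funext fun x => ofReal_hermiteFun _ _ x
  set F := iterConv n fun i => fab (a i) (b i) with hFdef
  obtain ⟨P, hP⟩ := exists_map_ofReal_eq (Q := Q) fun x => by
    have h3 := congrArg Complex.im (congrFun hconvQ x)
    rw [polyGauss, Complex.im_mul_ofReal, Complex.ofReal_im] at h3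
    exact (mul_eq_zero.mp h3.symm).resolve_right (Real.exp_pos _).ne'
  have hFP : F = hermiteFun P ((n : ℝ) + 1)⁻¹ := by
    ext x
    have h3 := congrFun hconvQ x
    rw [← hP, ← ofReal_hermiteFun] at h3
    exact_mod_cast h3
  have hmem : F ∈ posCone := by
    refine ⟨hFP ▸ continuous_hermiteFun _ _, fun x => ?_, ?_⟩
    · obtain ⟨B, c, hc, hB⟩ := exists_hermiteFun_le_gaussian (∏ i, fabPoly (-a i) (b i)) hn
      have h3 := fourierHat_nonneg_of_le_gaussian hq hc hB x
      rw [← h2] at h3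
      exact Complex.zero_le_real.mp h3
    · exact isPositiveDefinite_of_fourierHat hq.2.1 (integrable_hermiteFun _ hn)
        fun x => congrFun h2 x
  refine ⟨?_, fun hb => ⟨P, ?_, by rw [hFP, one_div]⟩⟩
  · obtain ⟨B, c, hc, hB⟩ := exists_hermiteFun_le_gaussian P (inv_pos.mpr hn)
    refine isExtremal_of_fourierHat_real_zeros hmem hc (fun x => by rw [hFP]; exact hB x) hn h1'
      ((Polynomial.map_ne_zero_iff Complex.ofReal_injective).mpr
        (Finset.prod_ne_zero_iff.mpr fun i _ h0 => (h i).1.2.1 ?_))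
      (prod_root_im_eq_zero fun i => fabPoly_root_im_eq_zero ?_)
    · have h4 := fourierHat_fab (-a i) (b i)
      have h5 : fab (-a i) (b i) = 0 := by
        rw [fab_eq_hermiteFun, h0, hermiteFun_eq_zero_iff]
      rw [h5, neg_neg] at h4
      ext x
      have h6 := congrFun h4 x
      simp only [fourierHat, fourier_eq_integral_exp_mul, Pi.zero_apply, Complex.ofReal_zero,
        mul_zero, integral_zero] at h6
      exact_mod_cast h6.symm
    · rw [← fourierHat_fab]
      exact (h i).2.1
  · have h3 : Q.natDegree = ((∏ i, fabPoly (-a i) (b i)).map Complex.ofRealHom).natDegree :=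
      natDegree_eq_of_degree_eq hQd
    rw [natDegree_map_eq_of_injective Complex.ofReal_injective,
      natDegree_prod_fabPoly (fun i => -a i) hb, ← hP,
      natDegree_map_eq_of_injective Complex.ofReal_injective] at h3
    exact h3

/-! ### Extremal Hermite functions of arbitrarily high degree -/

lemma eval_fabPoly (a b x : ℝ) : (fabPoly a b).eval x =
    1 + 2 * a * (4 * Real.pi * x ^ 2 - 1) +
      b * ((4 * Real.pi * x ^ 2) ^ 2 - 6 * (4 * Real.pi * x ^ 2) + 3) := by
  simp [fabPoly, H₀, H₂, H₄]

/-- With `t = 4πx²`, these parameters give the polynomial `(t - 6)² / 27`, which has only real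
zeros, while the transform has `(t² + 24) / 27 > 0`. -/
lemma isPositiveDefinite_fab_neg_ninth : IsPositiveDefinite (fab (-(1 / 9)) (1 / 27)) := by
  refine isPositiveDefinite_of_fourierHat (u := fab (1 / 9) (1 / 27)) (fun x => ?_)
    (integrable_hermiteFun _ one_pos) fun x => (congrFun (fourierHat_fab _ _) x).symm
  rw [fab_eq_hermiteFun, hermiteFun, eval_fabPoly]
  refine mul_nonneg ?_ (Real.exp_pos _).le
  nlinarith [sq_nonneg (4 * Real.pi * x ^ 2)]

theorem exists_isExtremal_hermiteFun (n : ℕ) :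
    ∃ P : ℝ[X], P.natDegree = 4 * (n + 1) ∧ IsExtremal (hermiteFun P 1) := by
  have hn : (0 : ℝ) < (n : ℝ) + 1 := by positivity
  have hc : 0 < 4 * Real.pi / ((n : ℝ) + 1) := by positivity
  set c := 4 * Real.pi / ((n : ℝ) + 1) with hcdef
  set q : ℝ[X] := C c * X ^ 2 - C 6 with hq
  have hqd : q.natDegree = 2 := by
    rw [hq]
    compute_degree!
    exact hc.ne'
  have hq0 : q ≠ 0 := fun h => by simp [h] at hqd
  -- Shrinking the variable by `√(n + 1)` before taking the power `n + 1` restores the Gaussian `exp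
  -- (-πx²)`; `27 ^ (n + 1)` clears the denominators.
  have hexp : ∀ x : ℝ, hermiteFun (q ^ (2 * (n + 1))) 1 x = 27 ^ (n + 1) *
      ∏ _i : Fin (n + 1), fab (-(1 / 9)) (1 / 27) ((√((n : ℝ) + 1))⁻¹ * x) := fun x => by
    have hsq : ((√((n : ℝ) + 1))⁻¹ * x) ^ 2 = x ^ 2 / ((n : ℝ) + 1) := by
      rw [mul_pow, inv_pow, Real.sq_sqrt hn.le]
      ring
    rw [Finset.prod_const, Finset.card_univ, Fintype.card_fin, ← mul_pow, fab_eq_hermiteFun,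
      hermiteFun, hermiteFun, eval_fabPoly, hsq, ← mul_assoc,
      mul_pow _ (Real.exp _), ← Real.exp_nat_mul, pow_mul, eval_pow, eval_pow]
    congr 2
    · simp [hq, hcdef]
      field_simp
      ring
    · push_cast
      field_simp
  refine ⟨q ^ (2 * (n + 1)), by rw [natDegree_pow, hqd]; ring, ?_⟩
  refine isExtremal_of_real_zeros one_pos ⟨continuous_hermiteFun _ _, fun x => ?_, ?_⟩
    (pow_ne_zero _ hq0) fun z hz => ?_
  · rw [hermiteFun, pow_mul, eval_pow, eval_pow]
    positivity
  · have h1 := ((IsPositiveDefinite.prod (Finset.univ : Finset (Fin (n + 1)))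
      fun _ _ => isPositiveDefinite_fab_neg_ninth.comp_mul (√((n : ℝ) + 1))⁻¹).const_mul
        (show (0 : ℝ) ≤ 27 ^ (n + 1) by positivity))
    rwa [← funext hexp] at h1
  · rw [Polynomial.map_pow, IsRoot.def, eval_pow] at hz
    have h1 := eq_zero_of_pow_eq_zero hz
    simp only [hq, Polynomial.map_sub, Polynomial.map_mul, map_C, Polynomial.map_pow, map_X,
      eval_sub, eval_mul, eval_C, eval_pow, eval_X, Complex.ofRealHom_eq_coe] at h1
    -- At a root `c z² = 6` with `c > 0`: a non-real `z` would be purely imaginary, making `c z²`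
    -- non-positive.
    have hre := congrArg Complex.re h1
    have him := congrArg Complex.im h1
    simp [pow_two] at hre him
    by_contra hz0
    have h2 : z.re = 0 := by
      rcases him with h | h
      · exact absurd h hc.ne'
      · exact (mul_eq_zero.mp (by linarith : z.re * z.im = 0)).resolve_right hz0
    rw [h2] at hre
    nlinarith [mul_nonneg hc.le (mul_self_nonneg z.im)]

end HermiteRays

end

theorem mainTheorem7 :
    (∀ (n : ℕ) (a b : Fin (n + 1) → ℝ), (∀ i, HermiteRays.IsTimeType (a i) (b i)) →
      HermiteRays.IsExtremal (fun x => ∏ i, HermiteRays.fab (a i) (b i) x) ∧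
      ((∀ i, b i ≠ 0) → ∃ P : Polynomial ℝ, P.natDegree = 4 * (n + 1) ∧
        (fun x => ∏ i, HermiteRays.fab (a i) (b i) x) =
          HermiteRays.hermiteFun P ((n : ℝ) + 1))) ∧
    (∀ (n : ℕ) (a b : Fin (n + 1) → ℝ), (∀ i, HermiteRays.IsFrequencyType (a i) (b i)) →
      HermiteRays.IsExtremal
        (HermiteRays.iterConv n (fun i => HermiteRays.fab (a i) (b i))) ∧
      ((∀ i, b i ≠ 0) → ∃ P : Polynomial ℝ, P.natDegree = 4 * (n + 1) ∧
        HermiteRays.iterConv n (fun i => HermiteRays.fab (a i) (b i)) =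
          HermiteRays.hermiteFun P (1 / ((n : ℝ) + 1)))) ∧
    (∀ n : ℕ, ∃ P : Polynomial ℝ, P.natDegree = 4 * (n + 1) ∧
      HermiteRays.IsExtremal (HermiteRays.hermiteFun P 1)) := by
  refine ⟨fun n a b h => ⟨HermiteRays.isExtremal_prod_of_isTimeType h, fun hb =>
    ⟨_, HermiteRays.natDegree_prod_fabPoly a hb, HermiteRays.prod_fab_eq_hermiteFun a b⟩⟩,
    fun n a b h => HermiteRays.iterConv_of_isFrequencyType h,
    HermiteRays.exists_isExtremal_hermiteFun⟩
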